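/- Let $a,b,A,B\in\mathbb{C}\setminus\{0\}$ and consider the potential $$v(x)=a e^{-2ix}+b e^{2ix}+A e^{-4ix}+B e^{4ix},\qquad V(m)=\frac1\pi\int_0^\pi v(x)e^{-imx}\,dx\quad(m\in 2\mathbb{Z}).$$ An admissible walk from $-n$ to $n$ (respectively from $n$ to $-n$), $n\in\mathbb{N}$, is a finite sequence of steps $x=(x(t))_{t=1}^{\nu+1}$, $\nu=\nu(x)\ge 1$, $x(t)\in 2\mathbb{Z}$, with $\sum_{t=1}^{\nu+1}x(t)=2n$ (respectively $-2n$), whose vertices $j(t)=-n+\sum_{i\le t}x(i)$ (respectively $j(t)=n+\sum_{i\le t}x(i)$) satisfy $j(t)\ne\pm n$ for $1\le t\le\nu$. Let $X_n$ (respectively $Y_n$) be the set of these walks, and put $$h(x,z)=\frac{\prod_{t=1}^{\nu+1}V(x(t))}{\prod_{t=1}^{\nu}\left(n^2-j(t)^2+z\right)},\qquad B^+(n,z)=\sum_{x\in X_n}h(x,z),\qquad B^-(n,z)=\sum_{x\in Y_n}h(x,z).$$ Let $\alpha,\beta,\tau,\sigma\in\mathbb{C}$ (necessarily nonzero) satisfy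 $$A=-\alpha^2,\qquad a=-2\tau\alpha,\qquad B=-\beta^2,\qquad b=-2\sigma\beta .$$ If $\tau$ and $\sigma$ are not integers, then for all sufficiently large $n$ and all $z\in\mathbb{C}$ with $|z|\le 1$ the series defining $B^\pm(n,z)$ converge absolutely, and, as $n\to\infty$, uniformly in $|z|\le 1$, $$B^+(n,z)=\frac{4(i\beta/2)^n}{((n-2)!!)^2}\cos\Big(\frac{\pi\sigma}{2}\Big)\Big(1+O\Big(\frac{\log n}{n}\Big)\Big),\qquad B^-(n,z)=\frac{4(i\alpha/2)^n}{((n-2)!!)^2}\cos\Big(\frac{\pi\tau}{2}\Big)\Big(1+O\Big(\frac{\log n}{n}\Big)\Big)$$ for even $n$, and $$B^+(n,z)=\frac{4i(i\beta/2)^n}{((n-2)!!)^2}\,\frac{2}{\pi}\sin\Big(\frac{\pi\sigma}{2}\Big)\Big(1+O\Big(\frac{\log n}{n}\Big)\Big),\qquad B^-(n,z)=\frac{4i(i\alpha/2)^n}{((n-2)!!)^2}\,\frac{2}{\pi}\sin\Big(\frac{\pi\tau}{2}\Big)\Big(1+O\Big(\frac{\log n}{n}\Big)\Big)$$ for odd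 $n$. -/

import Mathlib

noncomputable section

/-- The potential `v(x) = a e^{-2ix} + b e^{2ix} + A e^{-4ix} + B e^{4ix}`. -/
def hillPotential (a b A B : ℂ) (x : ℝ) : ℂ :=
  a * Complex.exp (-2 * Complex.I * x) + b * Complex.exp (2 * Complex.I * x)
    + A * Complex.exp (-4 * Complex.I * x) + B * Complex.exp (4 * Complex.I * x)

/-- The Fourier coefficient `V(m)` (`m` an even integer) of a `π`-periodic function `v`
with respect to the system `e^{imx}`, `m ∈ 2ℤ`, on `[0, π]`. -/
def fourierCoeffPi (v : ℝ → ℂ) (m : ℤ) : ℂ :=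
  (1 / (Real.pi : ℂ)) * ∫ x in (0 : ℝ)..Real.pi, v x * Complex.exp (-(Complex.I * m * x))

/-- The vertex `j(t) = s + x(1) + ⋯ + x(t)` of the walk with start `s` and list of steps `x`. -/
def walkVertex (s : ℤ) (x : List ℤ) (t : ℕ) : ℤ :=
  s + (x.take t).sum

/-- The set of admissible walks from `s` to `-s`, given by their lists of steps
`x(1), …, x(ν + 1)`, `ν ≥ 1`: all steps are even, the walk ends at `-s`, and the intermediate
vertices `j(1), …, j(ν)` are different from `s` and `-s`. -/
def admissibleWalks (s : ℤ) : Set (List ℤ) :=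
  {x | 2 ≤ x.length ∧ (∀ m ∈ x, Even m) ∧ x.sum = -2 * s ∧
    ∀ t : ℕ, 1 ≤ t → t < x.length → walkVertex s x t ≠ s ∧ walkVertex s x t ≠ -s}

/-- The weight `h(x, z) = ∏_{t=1}^{ν+1} V(x(t)) / ∏_{t=1}^{ν} (n² - j(t)² + z)` of a walk `x`
with start `s`, where `s = ± n`, so that `n² = s²`. -/
def walkWeight (V : ℤ → ℂ) (s : ℤ) (x : List ℤ) (z : ℂ) : ℂ :=
  (x.map V).prod /
    ∏ t ∈ Finset.Ico 1 x.length, ((s : ℂ) ^ 2 - (walkVertex s x t : ℂ) ^ 2 + z)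

/-- `B⁺(n, z)`: the sum of `h(x, z)` over all admissible walks from `-n` to `n`. -/
def walkSumPlus (v : ℝ → ℂ) (n : ℕ) (z : ℂ) : ℂ :=
  ∑' x : admissibleWalks (-(n : ℤ)), walkWeight (fourierCoeffPi v) (-(n : ℤ)) x z

/-- `B⁻(n, z)`: the sum of `h(x, z)` over all admissible walks from `n` to `-n`. -/
def walkSumMinus (v : ℝ → ℂ) (n : ℕ) (z : ℂ) : ℂ :=
  ∑' x : admissibleWalks (n : ℤ), walkWeight (fourierCoeffPi v) (n : ℤ) x z

end

/-!
Let `l` be half the displacement that a walk still has to cover. A vertex is then `j = ±(n - 2l)`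
and `n² - j² = 4l(n - l)`, so that the walks become paths on `ℤ` from `n` to `0` with steps
`1, 2, -1, -2`, weighted by products of vertex and step weights.

The paths with steps `1` and `2` only dominate. At `z = 0` their total weight solves a three-term
recurrence in `l`. Its generating function is annihilated by a second-order differential operator
which an exponential factor conjugates to a confluent hypergeometric one, with a two-term
recurrence; this is where the parametrization `B = -β²`, `b = -2σβ` is used. The sum over these
paths is therefore a finite product, equal to the leading factor times a partial product of
Euler's product for `cos (πσ/2)` or `sin (πσ/2)`, which converges at rate `1/n`.

The remaining paths, and the dependence on `z`, cost a relative error `O(log n / n)`. Dominating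
the difference of two weights by the difference of their majorants reduces this to paths with
positive weights, for which a supersolution of the recurrence is explicit: the sum over the
monotone paths times `1 + M ∑ 1/(n² - j²)`, where `∑ 1/(n² - j²) = O(log n / n)`. This is of the
same order as the leading factor because the absolute values of `b` and `B` are again of the form
`-2σβ` and `-β²`, with imaginary `σ` and `β`.
-/

/-- `X` and `Y` majorize the pair `x`, `y`: not only is `‖y‖ ≤ Y`, but also the difference
`x - y` is dominated by the difference of the majorants. Unlike a plain bound for `‖x - y‖`, this
is preserved by products. -/
structure MajorizedPair {E : Type*} [SeminormedAddCommGroup E] (x y : E) (X Y : ℝ) : Prop where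
  norm_snd_le : ‖y‖ ≤ Y
  norm_sub_le : ‖x - y‖ ≤ X - Y

namespace MajorizedPair

theorem norm_fst_le {E : Type*} [SeminormedAddCommGroup E] {x y : E} {X Y : ℝ}
    (h : MajorizedPair x y X Y) : ‖x‖ ≤ X := by
  linarith [norm_le_norm_add_norm_sub' x y, h.norm_snd_le, h.norm_sub_le]

theorem mul {R : Type*} [NonUnitalSeminormedRing R] {x y x' y' : R} {X Y X' Y' : ℝ}
    (h : MajorizedPair x y X Y) (h' : MajorizedPair x' y' X' Y') :
    MajorizedPair (x * x') (y * y') (X * X') (Y * Y') where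
  norm_snd_le := norm_mul_le_of_le h.norm_snd_le h'.norm_snd_le
  norm_sub_le :=
    calc ‖x * x' - y * y'‖ = ‖(x - y) * x' + y * (x' - y')‖ := by noncomm_ring
      _ ≤ (X - Y) * X' + Y * (X' - Y') := norm_add_le_of_le
          (norm_mul_le_of_le h.norm_sub_le h'.norm_fst_le)
          (norm_mul_le_of_le h.norm_snd_le h'.norm_sub_le)
      _ = X * X' - Y * Y' := by ring

theorem summable_and_tsum {ι E : Type*} [NormedAddCommGroup E] [CompleteSpace E]
    {f f₀ : ι → E} {F F₀ : ι → ℝ} {s₀ : E} {Φ S₀ : ℝ}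
    (h : ∀ i, MajorizedPair (f i) (f₀ i) (F i) (F₀ i))
    (hf₀ : HasSum f₀ s₀) (hF₀ : HasSum F₀ S₀) (hΦ : ∀ t : Finset ι, ∑ i ∈ t, F i ≤ Φ) :
    Summable f ∧ MajorizedPair (∑' i, f i) s₀ Φ S₀ := by
  have hnonneg (i : ι) : 0 ≤ F i := (norm_nonneg _).trans (h i).norm_fst_le
  have hF : Summable F := summable_of_sum_le hnonneg hΦ
  have hf : Summable f := hF.of_norm_bounded fun i => (h i).norm_fst_le
  refine ⟨hf, hf₀.norm_le_of_bounded hF₀ fun i => (h i).norm_snd_le, ?_⟩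
  calc ‖∑' i, f i - s₀‖ ≤ ∑' i, F i - S₀ :=
        (hf.hasSum.sub hf₀).norm_le_of_bounded (hF.hasSum.sub hF₀) fun i => (h i).norm_sub_le
    _ ≤ Φ - S₀ := sub_le_sub_right (hF.tsum_le_of_sum_le hΦ) _

end MajorizedPair

section Paths

theorem hasSum_list {α M : Type*} [AddCommMonoid M] [TopologicalSpace M] [ContinuousAdd M]
    {f : List α → M} {S : Finset α} {a : α → M} (hf : ∀ m ∉ S, ∀ x, f (m :: x) = 0)
    (ha : ∀ m ∈ S, HasSum (fun x => f (m :: x)) (a m)) :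
    HasSum f (f [] + ∑ m ∈ S, a m) := by
  classical
  let g (m : α) : List α → M := Function.extend (List.cons m) (fun x => f (m :: x)) 0
  have hg_self (m : α) (x : List α) : g m (m :: x) = f (m :: x) :=
    (List.cons_injective (a := m)).extend_apply _ _ x
  have hg_ne {m : α} {x : List α} (h : ∀ y, m :: y ≠ x) : g m x = 0 :=
    Function.extend_apply' _ _ _ fun ⟨y, hy⟩ => h y hy
  have hsplit (x : List α) : f x = (if x = [] then f [] else 0) + ∑ m ∈ S, g m x := by
    rcases x with _ | ⟨k, x⟩
    · simp [hg_ne]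
    · rw [if_neg (List.cons_ne_nil k x), zero_add]
      by_cases hk : k ∈ S
      · rw [Finset.sum_eq_single_of_mem k hk fun m _ hmk => hg_ne (by simp [hmk]), hg_self]
      · rw [hf k hk, Finset.sum_eq_zero fun m hm => hg_ne ?_]
        rintro y hy
        exact hk ((List.cons_eq_cons.1 hy).1 ▸ hm)
  have hg (m : α) (hm : m ∈ S) : HasSum (g m) (a m) :=
    (hasSum_extend_zero List.cons_injective).2 (ha m hm)
  exact ((hasSum_ite_eq [] (f [])).add (hasSum_sum hg)).congr_fun hsplit

variable {G R : Type*} [AddCommGroup G] [DecidableEq G]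

/-- The weight of a path that has the displacement `l` still to cover, with the list `x` of its
remaining steps: the product of the vertex weights `d` at the displacements still to be covered
before each step, and of the step weights `c`. It is `0` if the steps do not add up to `l`. -/
def pathWeight [Semiring R] (c d : G → R) : G → List G → R
  | l, [] => if l = 0 then 1 else 0
  | l, m :: x => d l * c m * pathWeight c d (l - m) x

/-- The weight of a path of displacement `n`, without the vertex weight of its starting point. -/
def openPathWeight [Semiring R] (c d : G → R) (n : G) : List G → R
  | [] => 0
  | m :: x => c m * pathWeight c d (n - m) x

theorem pathWeight_eq_ite [CommSemiring R] (c d : G → R) (l : G) (x : List G) :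
    pathWeight c d l x = if x.sum = l then
      (x.map c).prod * ∏ t ∈ Finset.range x.length, d (l - (x.take t).sum) else 0 := by
  induction x generalizing l with
  | nil => simp [pathWeight, eq_comm]
  | cons m x ih =>
    simp only [pathWeight, ih, List.sum_cons, List.map_cons, List.prod_cons, List.length_cons,
      Finset.prod_range_succ', List.take_succ_cons, List.take_zero, List.sum_nil, sub_zero,
      eq_sub_iff_add_eq', sub_add_eq_sub_sub]
    split_ifs <;> ring

theorem hasSum_pathWeight [Semiring R] [TopologicalSpace R] [IsTopologicalSemiring R]
    {c : G → R} (d : G → R) {S : Finset G} (hc : ∀ m ∉ S, c m = 0) {l : G} {s : G → R}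
    (hs : ∀ m ∈ S, HasSum (pathWeight c d (l - m)) (s m)) :
    HasSum (pathWeight c d l) ((if l = 0 then 1 else 0) + d l * ∑ m ∈ S, c m * s m) := by
  rw [Finset.mul_sum]
  simp_rw [← mul_assoc]
  exact hasSum_list (fun m hm x => by simp [pathWeight, hc m hm])
    fun m hm => (hs m hm).mul_left _

theorem hasSum_openPathWeight [Semiring R] [TopologicalSpace R] [IsTopologicalSemiring R]
    {c : G → R} (d : G → R) {S : Finset G} (hc : ∀ m ∉ S, c m = 0) {n : G} {s : G → R}
    (hs : ∀ m ∈ S, HasSum (pathWeight c d (n - m)) (s m)) :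
    HasSum (openPathWeight c d n) (∑ m ∈ S, c m * s m) := by
  rw [← zero_add (Finset.sum S _)]
  exact hasSum_list (fun m hm x => by simp [openPathWeight, hc m hm])
    fun m hm => (hs m hm).mul_left _

theorem MajorizedPair.pathWeight [NormedRing R] [NormOneClass R] {c d c₀ d₀ : G → R}
    {C D C₀ D₀ : G → ℝ} (hc : ∀ m, MajorizedPair (c m) (c₀ m) (C m) (C₀ m))
    (hd : ∀ l, MajorizedPair (d l) (d₀ l) (D l) (D₀ l)) (l : G) (x : List G) :
    MajorizedPair (pathWeight c d l x) (pathWeight c₀ d₀ l x) (pathWeight C D l x)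
      (pathWeight C₀ D₀ l x) := by
  induction x generalizing l with
  | nil => by_cases hl : l = 0 <;> constructor <;> simp [_root_.pathWeight, hl]
  | cons m x ih => exact ((hd l).mul (hc m)).mul (ih (l - m))

theorem MajorizedPair.openPathWeight [NormedRing R] [NormOneClass R] {c d c₀ d₀ : G → R}
    {C D C₀ D₀ : G → ℝ} (hc : ∀ m, MajorizedPair (c m) (c₀ m) (C m) (C₀ m))
    (hd : ∀ l, MajorizedPair (d l) (d₀ l) (D l) (D₀ l)) (n : G) (x : List G) :
    MajorizedPair (openPathWeight c d n x) (openPathWeight c₀ d₀ n x) (openPathWeight C D n x)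
      (openPathWeight C₀ D₀ n x) := by
  rcases x with _ | ⟨m, x⟩
  · constructor <;> simp [_root_.openPathWeight]
  · exact (hc m).mul (.pathWeight hc hd (n - m) x)

/-- A nonnegative supersolution of the recursion that the total weight of all paths with steps
in `S` satisfies as a function of the displacement to cover. -/
structure IsSupersolution (S : Finset G) (c d Φ : G → ℝ) : Prop where
  nonneg : ∀ l, 0 ≤ Φ l
  le : ∀ l, (if l = 0 then 1 else 0) + d l * ∑ m ∈ S, c m * Φ (l - m) ≤ Φ l

section Supersolution

variable {S : Finset G} {c d Φ : G → ℝ}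

theorem IsSupersolution.exists_hasSum_length_lt (hΦ : IsSupersolution S c d Φ)
    (hc : ∀ m, 0 ≤ c m) (hd : ∀ l, 0 ≤ d l) (hS : ∀ m ∉ S, c m = 0) (L : ℕ) (l : G) :
    ∃ s ≤ Φ l, HasSum (fun x => if x.length < L then pathWeight c d l x else 0) s := by
  induction L generalizing l with
  | zero => exact ⟨0, hΦ.nonneg l, by simp⟩
  | succ L ih =>
    choose s hs_le hs using ih
    refine ⟨_, ?_, hasSum_list (S := S) (a := fun m => d l * c m * s (l - m)) ?_ ?_⟩
    · refine le_trans ?_ (hΦ.le l)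
      simp only [List.length_nil, Nat.succ_pos, if_true, pathWeight, mul_assoc, ← Finset.mul_sum]
      gcongr with m
      · exact hd l
      · exact hc m
      · exact hs_le _
    · intro m hm x
      simp [pathWeight, hS m hm]
    · intro m _
      simpa [pathWeight] using (hs (l - m)).mul_left (d l * c m)

theorem pathWeight_nonneg (hc : ∀ m, 0 ≤ c m) (hd : ∀ l, 0 ≤ d l) (l : G) (x : List G) :
    0 ≤ pathWeight c d l x := by
  induction x generalizing l with
  | nil => unfold pathWeight; positivity
  | cons m x ih => exact mul_nonneg (mul_nonneg (hd l) (hc m)) (ih (l - m))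

theorem IsSupersolution.sum_pathWeight_le (hΦ : IsSupersolution S c d Φ)
    (hc : ∀ m, 0 ≤ c m) (hd : ∀ l, 0 ≤ d l) (hS : ∀ m ∉ S, c m = 0) (l : G)
    (t : Finset (List G)) : ∑ x ∈ t, pathWeight c d l x ≤ Φ l := by
  obtain ⟨s, hs_le, hs⟩ :=
    hΦ.exists_hasSum_length_lt hc hd hS (t.sup List.length + 1) l
  calc ∑ x ∈ t, pathWeight c d l x
      = ∑ x ∈ t, if x.length < t.sup List.length + 1 then pathWeight c d l x else 0 :=
        Finset.sum_congr rfl fun x hx => (if_pos (Nat.lt_succ_of_le (Finset.le_sup hx))).symm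
    _ ≤ s := sum_le_hasSum t (fun x _ => by
        have := pathWeight_nonneg hc hd l x
        positivity) hs
    _ ≤ Φ l := hs_le

theorem IsSupersolution.sum_openPathWeight_le (hΦ : IsSupersolution S c d Φ)
    (hc : ∀ m, 0 ≤ c m) (hd : ∀ l, 0 ≤ d l) (hS : ∀ m ∉ S, c m = 0) (n : G)
    (t : Finset (List G)) :
    ∑ x ∈ t, openPathWeight c d n x ≤ ∑ m ∈ S, c m * Φ (n - m) := by
  have hsum (l : G) : Summable (pathWeight c d l) :=
    summable_of_sum_le (pathWeight_nonneg hc hd l) (hΦ.sum_pathWeight_le hc hd hS l)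
  have hnonneg (x : List G) : 0 ≤ openPathWeight c d n x := by
    rcases x with _ | ⟨m, x⟩
    · exact le_rfl
    · exact mul_nonneg (hc m) (pathWeight_nonneg hc hd _ x)
  calc ∑ x ∈ t, openPathWeight c d n x ≤ ∑ m ∈ S, c m * ∑' x, pathWeight c d (n - m) x :=
        sum_le_hasSum t (fun x _ => hnonneg x)
          (hasSum_openPathWeight d hS fun m _ => (hsum (n - m)).hasSum)
    _ ≤ ∑ m ∈ S, c m * Φ (n - m) := by
        gcongr with m
        · exact hc m
        · exact (hsum _).tsum_le_of_sum_le (hΦ.sum_pathWeight_le hc hd hS _)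

end Supersolution

end Paths

section MonotonePaths

variable {R : Type*}

/-- The step weights on `ℤ` of the steps `1`, `2`, `-1` and `-2` (in this order); all other steps
have weight `0`. -/
def stepWeight [Zero R] (b B a A : R) (m : ℤ) : R :=
  if m = 1 then b else if m = 2 then B else if m = -1 then a else if m = -2 then A else 0

/-- The steps that occur in the walks for a potential with four Fourier coefficients. -/
def hillSteps : Finset ℤ := {1, 2, -1, -2}

theorem stepWeight_of_notMem [Zero R] (b B a A : R) {m : ℤ} (hm : m ∉ hillSteps) :
    stepWeight b B a A m = 0 := by
  simp only [hillSteps, Finset.mem_insert, Finset.mem_singleton, not_or] at hm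
  simp [stepWeight, hm]

theorem stepWeight_nonneg {b B a A : ℝ} (hb : 0 ≤ b) (hB : 0 ≤ B) (ha : 0 ≤ a) (hA : 0 ≤ A)
    (m : ℤ) : 0 ≤ stepWeight b B a A m := by
  unfold stepWeight
  split_ifs <;> first | assumption | exact le_rfl

theorem majorizedPair_stepWeight {b B a A : ℂ} {b' B' a' A' : ℝ} (hb : ‖b‖ ≤ b') (hB : ‖B‖ ≤ B')
    (ha : ‖a‖ ≤ a') (hA : ‖A‖ ≤ A') (m : ℤ) :
    MajorizedPair (stepWeight b B a A m) (stepWeight b B 0 0 m) (stepWeight b' B' a' A' m)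
      (stepWeight b' B' 0 0 m) := by
  constructor <;> unfold stepWeight <;> split_ifs <;> simp [*]

theorem sum_hillSteps [Semiring R] (b B a A : R) (f : ℤ → R) (l : ℤ) :
    ∑ m ∈ hillSteps, stepWeight b B a A m * f (l - m)
      = b * f (l - 1) + B * f (l - 2) + a * f (l + 1) + A * f (l + 2) := by
  simp [hillSteps, stepWeight, add_assoc]

/-- The total weight of the paths of displacement `l` all of whose steps are `1` (of weight `b`)
or `2` (of weight `B`), computed by splitting off the first step. -/
def monotoneSum [Semiring R] (b B : R) (d : ℤ → R) (l : ℤ) : R :=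
  if l < 0 then 0 else if l = 0 then 1
  else d l * (b * monotoneSum b B d (l - 1) + B * monotoneSum b B d (l - 2))
termination_by l.toNat

section

variable [Semiring R] (b B : R) (d : ℤ → R)

theorem monotoneSum_of_neg {l : ℤ} (hl : l < 0) : monotoneSum b B d l = 0 := by
  rw [monotoneSum, if_pos hl]

theorem monotoneSum_zero : monotoneSum b B d 0 = 1 := by
  simp [monotoneSum]

theorem monotoneSum_of_pos {l : ℤ} (hl : 0 < l) : monotoneSum b B d l
    = d l * (b * monotoneSum b B d (l - 1) + B * monotoneSum b B d (l - 2)) := by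
  rw [monotoneSum, if_neg hl.not_gt, if_neg hl.ne']

theorem map_monotoneSum {R' : Type*} [Semiring R'] (f : R →+* R') (l : ℤ) :
    f (monotoneSum b B d l) = monotoneSum (f b) (f B) (fun l => f (d l)) l := by
  induction l using monotoneSum.induct with
  | case1 l hl => simp [monotoneSum_of_neg, hl]
  | case2 => simp [monotoneSum_zero]
  | case3 l h1 h2 ih1 ih2 =>
    have hl : 0 < l := by lia
    rw [monotoneSum_of_pos b B d hl, monotoneSum_of_pos _ _ _ hl]
    simp only [map_mul, map_add, ih1, ih2]

theorem pathWeight_of_neg {l : ℤ} (hl : l < 0) (x : List ℤ) :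
    pathWeight (stepWeight b B 0 0) d l x = 0 := by
  induction x generalizing l with
  | nil => simp [pathWeight, hl.ne]
  | cons m x ih =>
    rcases lt_or_ge 0 m with hm | hm
    · rw [pathWeight, ih (by lia), mul_zero]
    · simp [pathWeight, stepWeight, show m ≠ 1 by lia, show m ≠ 2 by lia]

theorem hasSum_monotoneSum [TopologicalSpace R] [IsTopologicalSemiring R] (l : ℤ) :
    HasSum (pathWeight (stepWeight b B 0 0) d l) (monotoneSum b B d l) := by
  have hrec (l : ℤ) {s : ℤ → R}
      (hs : ∀ m ∈ ({1, 2} : Finset ℤ), HasSum (pathWeight (stepWeight b B 0 0) d (l - m)) (s m)) :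
      HasSum (pathWeight (stepWeight b B 0 0) d l)
        ((if l = 0 then 1 else 0) + d l * (b * s 1 + B * s 2)) := by
    simpa [stepWeight] using hasSum_pathWeight d (fun m hm => by simp_all [stepWeight]) hs
  have hneg {l : ℤ} (hl : l < 0) : HasSum (pathWeight (stepWeight b B 0 0) d l) 0 :=
    hasSum_zero.congr_fun (pathWeight_of_neg b B d hl)
  induction l using monotoneSum.induct with
  | case1 l hl => exact monotoneSum_of_neg b B d hl ▸ hneg hl
  | case2 => simpa [monotoneSum_zero] using hrec 0 (s := 0) (by simp [hneg])
  | case3 l h1 h2 ih1 ih2 =>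
    rw [monotoneSum_of_pos b B d (by lia)]
    simpa [h2] using hrec l (s := fun m => monotoneSum b B d (l - m)) (by simp [ih1, ih2])

end

end MonotonePaths

section VertexWeights

/-- The number `n² - j²` at the vertex `j = ± (n - 2l)` of a walk between `n` and `-n`, where `l`
is half the displacement that the walk still has to cover. -/
def vertexGap (n l : ℤ) : ℤ :=
  4 * l * (n - l)

/-- The factor `1 / (n² - j² + z)` that a vertex contributes to the weight of a walk; the value
`0` at the vertices `± n` excludes the walks that visit them. -/
noncomputable def vertexWeight (n : ℤ) (z : ℂ) (l : ℤ) : ℂ :=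
  if vertexGap n l = 0 then 0 else ((vertexGap n l : ℂ) + z)⁻¹

/-- A bound for `vertexWeight n z` that is uniform in `‖z‖ ≤ 1`. -/
noncomputable def vertexMajorant (n l : ℤ) : ℝ :=
  if vertexGap n l = 0 then 0 else (|(vertexGap n l : ℝ)| - 1)⁻¹

theorem vertexGap_zero (n : ℤ) : vertexGap n 0 = 0 := by
  simp [vertexGap]

theorem four_le_abs_vertexGap {n l : ℤ} (h : vertexGap n l ≠ 0) :
    4 ≤ |(vertexGap n l : ℝ)| := by
  have : 1 ≤ |l * (n - l)| := Int.one_le_abs fun h0 => h (by simp [vertexGap, mul_assoc, h0])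
  rw [vertexGap, mul_assoc]
  push_cast
  rw [abs_mul, abs_of_pos four_pos]
  have : (1 : ℝ) ≤ |(l : ℝ) * (n - l)| := mod_cast this
  linarith

theorem majorizedPair_inv_add {x z : ℂ} (hx : 1 < ‖x‖) (hz : ‖z‖ ≤ 1) :
    MajorizedPair (x + z)⁻¹ x⁻¹ (‖x‖ - 1)⁻¹ ‖x‖⁻¹ := by
  have hxz : ‖x‖ - 1 ≤ ‖x + z‖ := by linarith [norm_sub_le_norm_add x z]
  have hpos : 0 < ‖x‖ - 1 := by linarith
  have hx0 : x ≠ 0 := norm_pos_iff.1 (by linarith)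
  have hxz0 : x + z ≠ 0 := norm_pos_iff.1 (hpos.trans_le hxz)
  refine ⟨(norm_inv x).le, ?_⟩
  rw [inv_sub_inv hxz0 hx0, inv_sub_inv hpos.ne' (by linarith), norm_div, norm_mul,
    sub_add_cancel_left, norm_neg, sub_sub_cancel]
  gcongr

theorem majorizedPair_vertexWeight (n l : ℤ) {z : ℂ} (hz : ‖z‖ ≤ 1) :
    MajorizedPair (vertexWeight n z l) (vertexGap n l : ℂ)⁻¹ (vertexMajorant n l)
      |(vertexGap n l : ℝ)|⁻¹ := by
  unfold vertexWeight vertexMajorant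
  split_ifs with h
  · constructor <;> simp [h]
  · have hnorm : ‖(vertexGap n l : ℂ)‖ = |(vertexGap n l : ℝ)| := Complex.norm_intCast _
    rw [← hnorm]
    exact majorizedPair_inv_add (by linarith [four_le_abs_vertexGap h]) hz

theorem vertexMajorant_nonneg (n l : ℤ) : 0 ≤ vertexMajorant n l := by
  unfold vertexMajorant
  split_ifs with h
  · exact le_rfl
  · exact inv_nonneg.2 (by linarith [four_le_abs_vertexGap h])

theorem vertexGap_pos {n l : ℤ} (h0 : 0 < l) (hn : l < n) : 0 < vertexGap n l :=
  mul_pos (by lia) (by lia)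

theorem vertexMajorant_of_lt {n l : ℤ} (h0 : 0 < l) (hn : l < n) :
    vertexMajorant n l = ((vertexGap n l : ℝ) - 1)⁻¹ := by
  have h := vertexGap_pos h0 hn
  rw [vertexMajorant, if_neg h.ne', abs_of_pos (mod_cast h)]

theorem vertexGap_le_two_mul {n l : ℤ} (h0 : 0 < l) (hn : l + 1 < n) :
    vertexGap n l ≤ 2 * vertexGap n (l + 1) := by
  unfold vertexGap
  nlinarith

theorem vertexMajorant_le_inv {n : ℕ} (hn : 0 < n) {l : ℤ} (hl : l < 0 ∨ n ≤ l) :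
    vertexMajorant n l ≤ (n : ℝ)⁻¹ := by
  unfold vertexMajorant
  split_ifs with h
  · positivity
  have habs : 4 * n ≤ -vertexGap n l := by
    unfold vertexGap
    have hl' : l < 0 ∨ n < l := hl.imp_right fun hnl => hnl.lt_of_ne fun h' => h (by
      simp [vertexGap, h'])
    rcases hl' with hl | hl <;> nlinarith
  have habs' : 4 * (n : ℝ) ≤ |(vertexGap n l : ℝ)| := le_trans (mod_cast habs) (neg_le_abs _)
  have hn1 : (1 : ℝ) ≤ n := mod_cast hn
  gcongr
  linarith

end VertexWeights

section Green

/-- The sum of `1 / |n² - j²|` over the remaining displacements `1, …, l`, that is, over the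
vertices of the walk from the current one to the last one before its end. Each of them offers a
detour, whose relative cost is of this order. -/
noncomputable def greenSum (n : ℕ) (l : ℤ) : ℝ :=
  ∑ i ∈ Finset.range l.toNat, |(vertexGap n (i + 1) : ℝ)|⁻¹

theorem greenSum_nonneg (n : ℕ) (l : ℤ) : 0 ≤ greenSum n l :=
  Finset.sum_nonneg fun _ _ => by positivity

theorem greenSum_mono (n : ℕ) : Monotone (greenSum n) := fun _ _ h =>
  Finset.sum_le_sum_of_subset_of_nonneg
    (Finset.range_mono (Int.toNat_le_toNat h)) fun _ _ _ => by positivity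

theorem greenSum_add_one {n : ℕ} {l : ℤ} (h0 : 0 ≤ l) (hn : l + 1 < n) :
    greenSum n (l + 1) = greenSum n l + (vertexGap n (l + 1) : ℝ)⁻¹ := by
  lift l to ℕ using h0
  have hpos : (0 : ℝ) < vertexGap n (l + 1) := mod_cast vertexGap_pos (by lia) hn
  rw [greenSum, show ((l : ℤ) + 1).toNat = l + 1 by lia, Finset.sum_range_succ, greenSum,
    Int.toNat_natCast, abs_of_pos hpos]

theorem greenSum_eq_harmonic (m : ℕ) :
    greenSum (m + 1) m = harmonic m / (2 * (m + 1)) := by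
  have hterm : ∀ i ∈ Finset.range m, |(vertexGap (m + 1 : ℕ) (i + 1) : ℝ)|⁻¹
      = (4 * (m + 1 : ℝ))⁻¹ * (((i : ℝ) + 1)⁻¹ + (((m - 1 - i : ℕ) : ℝ) + 1)⁻¹) := by
    intro i hi
    obtain ⟨j, rfl⟩ := Nat.exists_eq_add_of_lt (Finset.mem_range.1 hi)
    have hgap : (vertexGap (i + j + 1 + 1 : ℕ) (i + 1) : ℝ) = 4 * (i + 1) * (j + 1) := by
      push_cast [vertexGap]; ring
    rw [hgap, abs_of_pos (by positivity), show i + j + 1 - 1 - i = j by lia]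
    push_cast
    field
  have hharm : ∑ i ∈ Finset.range m, ((i : ℝ) + 1)⁻¹ = (harmonic m : ℝ) := by
    simp [harmonic]
  rw [greenSum, Int.toNat_natCast, Finset.sum_congr rfl hterm, ← Finset.mul_sum,
    Finset.sum_add_distrib, Finset.sum_range_reflect (fun i : ℕ => ((i : ℝ) + 1)⁻¹), hharm]
  field

theorem one_le_log_natCast {n : ℕ} (hn : 3 ≤ n) : 1 ≤ Real.log n := by
  rw [Real.le_log_iff_exp_le (by positivity)]
  exact Real.exp_one_lt_three.le.trans (mod_cast hn)

theorem inv_le_log_div {n : ℕ} (hn : 3 ≤ n) : (n : ℝ)⁻¹ ≤ Real.log n / n := by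
  rw [inv_eq_one_div]
  gcongr
  exact one_le_log_natCast hn

theorem greenSum_le_log {n : ℕ} (hn : 3 ≤ n) : greenSum n (n - 1) ≤ Real.log n / n := by
  have hlog := one_le_log_natCast hn
  obtain ⟨m, rfl⟩ := Nat.exists_eq_add_of_le' (by lia : 1 ≤ n)
  have hharm : (harmonic m : ℝ) ≤ 1 + Real.log (m + 1 : ℕ) :=
    (harmonic_le_one_add_log m).trans (by
      gcongr
      · exact mod_cast (by lia : 0 < m)
      · lia)
  rw [show ((m + 1 : ℕ) : ℤ) - 1 = m by lia, greenSum_eq_harmonic]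
  push_cast at *
  rw [div_le_div_iff₀ (by positivity) (by positivity)]
  nlinarith

end Green

section Supersolutions

variable {b B a A M : ℝ} {n : ℕ} {l : ℤ}

/-- The total weight of the monotone paths of displacement `l`, with the vertex weights
`1 / |n² - j²|`. -/
noncomputable def monotoneMajorant (b B : ℝ) (n l : ℤ) : ℝ :=
  monotoneSum b B (fun l => |(vertexGap n l : ℝ)|⁻¹) l

theorem monotoneMajorant_of_neg (hl : l < 0) : monotoneMajorant b B n l = 0 :=
  monotoneSum_of_neg _ _ _ hl

theorem monotoneMajorant_zero : monotoneMajorant b B n 0 = 1 :=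
  monotoneSum_zero _ _ _

theorem vertexGap_mul_monotoneMajorant (h0 : 0 < l) (hn : l < n) :
    vertexGap n l * monotoneMajorant b B n l
      = b * monotoneMajorant b B n (l - 1) + B * monotoneMajorant b B n (l - 2) := by
  have hpos : (0 : ℝ) < vertexGap n l := mod_cast vertexGap_pos h0 hn
  rw [monotoneMajorant, monotoneSum_of_pos _ _ _ h0, abs_of_pos hpos,
    mul_inv_cancel_left₀ hpos.ne']
  rfl

theorem monotoneMajorant_nonneg (hb : 0 ≤ b) (hB : 0 ≤ B) (n l : ℤ) :
    0 ≤ monotoneMajorant b B n l :=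
  (hasSum_monotoneSum b B _ l).nonneg <| pathWeight_nonneg
    (stepWeight_nonneg hb hB le_rfl le_rfl) (fun _ => by positivity) l

theorem mul_monotoneMajorant_sub_one_le (hb : 0 ≤ b) (hB : 0 ≤ B) (h0 : 0 < l) (hn : l < n) :
    b * monotoneMajorant b B n (l - 1) ≤ vertexGap n l * monotoneMajorant b B n l := by
  rw [vertexGap_mul_monotoneMajorant h0 hn]
  exact le_add_of_nonneg_right (mul_nonneg hB (monotoneMajorant_nonneg hb hB _ _))

/-- A bound for the ratio of two consecutive values of `monotoneMajorant b B n`. -/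
noncomputable def growthBound (b B : ℝ) : ℝ :=
  1 + b + 2 * B / b

theorem one_le_growthBound (hb : 0 < b) (hB : 0 ≤ B) : 1 ≤ growthBound b B := by
  have : 0 ≤ b + 2 * B / b := by positivity
  rw [growthBound]
  linarith

theorem monotoneMajorant_add_one_le (hb : 0 < b) (hB : 0 ≤ B) (h0 : 0 ≤ l) (hn : l + 1 < n) :
    monotoneMajorant b B n (l + 1) ≤ growthBound b B * monotoneMajorant b B n l := by
  set u := monotoneMajorant b B n
  have hu (k : ℤ) : 0 ≤ u k := monotoneMajorant_nonneg hb.le hB n k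
  have hrec := vertexGap_mul_monotoneMajorant (b := b) (B := B) (by lia : 0 < l + 1) hn
  rw [show l + 1 - 1 = l by lia, show l + 1 - 2 = l - 1 by lia] at hrec
  have hg : (1 : ℝ) ≤ vertexGap n (l + 1) := mod_cast vertexGap_pos (by lia) hn
  have hgap (hl : 0 < l) : (vertexGap n l : ℝ) ≤ 2 * vertexGap n (l + 1) :=
    mod_cast vertexGap_le_two_mul hl hn
  set g := (vertexGap n (l + 1) : ℝ)
  have hprev : B * u (l - 1) ≤ g * (2 * B / b * u l) := by
    rcases h0.eq_or_lt with rfl | hl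
    · rw [show u (0 - 1) = 0 from monotoneMajorant_of_neg (by lia), mul_zero]
      have := hu 0
      positivity
    calc B * u (l - 1) = B / b * (b * u (l - 1)) := by field
      _ ≤ B / b * (vertexGap n l * u l) := mul_le_mul_of_nonneg_left
          (mul_monotoneMajorant_sub_one_le hb.le hB hl (by lia)) (by positivity)
      _ ≤ B / b * (2 * g * u l) := by
          gcongr
          · exact hu l
          · exact hgap hl
      _ = g * (2 * B / b * u l) := by ring
  refine le_of_mul_le_mul_left ?_ (by linarith : 0 < g)
  calc g * u (l + 1) = b * u l + B * u (l - 1) := hrec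
    _ ≤ g * ((1 + b) * u l) + g * (2 * B / b * u l) := by
        have : b * u l ≤ (1 + b) * u l := by linarith [hu l]
        exact add_le_add
          (this.trans (le_mul_of_one_le_left (mul_nonneg (by linarith) (hu l)) hg)) hprev
    _ = g * (growthBound b B * u l) := by rw [growthBound]; ring

/-- A supersolution for paths with detours: monotone paths, with a relative correction
`M * greenSum n l` for the detours and suitable constants for the displacements `l` that are
outside the interval `[0, n)`. -/
noncomputable def detourMajorant (b B a A M : ℝ) (n : ℕ) (l : ℤ) : ℝ :=
  if l < 0 then (b + B + a + A) / n
  else if l < n then (1 + M * greenSum n l) * monotoneMajorant b B n l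
  else 2 * (b + B + a + A) / n * monotoneMajorant b B n (n - 1)

theorem detourMajorant_of_neg (hl : l < 0) :
    detourMajorant b B a A M n l = (b + B + a + A) / n :=
  if_pos hl

theorem detourMajorant_of_mem (h0 : 0 ≤ l) (hn : l < n) :
    detourMajorant b B a A M n l = (1 + M * greenSum n l) * monotoneMajorant b B n l := by
  rw [detourMajorant, if_neg h0.not_gt, if_pos hn]

theorem detourMajorant_of_le (hl : n ≤ l) : detourMajorant b B a A M n l
    = 2 * (b + B + a + A) / n * monotoneMajorant b B n (n - 1) := by
  rw [detourMajorant, if_neg (by lia), if_neg hl.not_gt]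

theorem mul_detourMajorant_sub_one (h0 : 0 < l) (hn : l ≤ n) :
    b * detourMajorant b B a A M n (l - 1)
    = (1 + M * greenSum n (l - 1)) * (b * monotoneMajorant b B n (l - 1)) := by
  rw [detourMajorant_of_mem (by lia) (by lia), mul_left_comm]

/-- The assumptions under which `detourMajorant b B a A M n` is a supersolution. -/
structure DetourRegime (b B a A M : ℝ) (n : ℕ) : Prop where
  b_pos : 0 < b
  B_nonneg : 0 ≤ B
  a_nonneg : 0 ≤ a
  A_nonneg : 0 ≤ A
  three_le : 3 ≤ n
  sum_le : b + B + a + A ≤ n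
  le_M : 2 + 2 * (a * growthBound b B + A * growthBound b B ^ 2)
    + 4 * B * (b + B + a + A) / b ≤ M
  M_mul_le : M * greenSum n (n - 1) ≤ 1

namespace DetourRegime

variable (h : DetourRegime b B a A M n)
include h

theorem growthBound_ge : 1 ≤ growthBound b B :=
  one_le_growthBound h.b_pos h.B_nonneg

theorem M_nonneg : 0 ≤ M := by
  have := h.growthBound_ge
  have := h.b_pos
  have := h.B_nonneg
  have := h.a_nonneg
  have := h.A_nonneg
  exact le_trans (by positivity) h.le_M

theorem sum_pos : 0 < b + B + a + A := by
  linarith [h.b_pos, h.B_nonneg, h.a_nonneg, h.A_nonneg]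

theorem sum_div_le : (b + B + a + A) / n ≤ 1 :=
  div_le_one_of_le₀ h.sum_le (by positivity)

theorem monotoneMajorant_nonneg (l : ℤ) : 0 ≤ monotoneMajorant b B n l :=
  _root_.monotoneMajorant_nonneg h.b_pos.le h.B_nonneg n l

theorem factor_nonneg (l : ℤ) : 0 ≤ 1 + M * greenSum n l := by
  have := mul_nonneg h.M_nonneg (greenSum_nonneg n l)
  linarith

theorem factor_mono {k l : ℤ} (hkl : k ≤ l) : 1 + M * greenSum n k ≤ 1 + M * greenSum n l := by
  gcongr
  · exact h.M_nonneg
  · exact greenSum_mono n hkl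

theorem factor_le_two (hl : l < n) : 1 + M * greenSum n l ≤ 2 := by
  linarith [h.factor_mono (by lia : l ≤ n - 1), h.M_mul_le]

theorem nonneg (l : ℤ) : 0 ≤ detourMajorant b B a A M n l := by
  have := h.sum_pos
  have := h.monotoneMajorant_nonneg
  unfold detourMajorant
  split_ifs
  · positivity
  · exact mul_nonneg (h.factor_nonneg l) (this l)
  · exact mul_nonneg (by positivity) (this _)

theorem le_two_mul (h0 : 0 ≤ l) (hn : l < n) :
    detourMajorant b B a A M n l ≤ 2 * monotoneMajorant b B n l := by
  rw [detourMajorant_of_mem h0 hn]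
  exact mul_le_mul_of_nonneg_right (h.factor_le_two hn) (h.monotoneMajorant_nonneg l)

theorem le_two_mul_of_le (hl : n - 1 ≤ l) :
    detourMajorant b B a A M n l ≤ 2 * monotoneMajorant b B n (n - 1) := by
  have h3 := h.three_le
  rcases hl.eq_or_lt with rfl | hl
  · exact h.le_two_mul (by lia) (by lia)
  · rw [detourMajorant_of_le (by lia), mul_div_assoc]
    have := h.monotoneMajorant_nonneg (n - 1)
    gcongr
    linarith [h.sum_div_le]

theorem le_one (hl : l ≤ 1) : detourMajorant b B a A M n l ≤ 1 := by
  have h3 := h.three_le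
  rcases lt_or_ge l 0 with hl0 | hl0
  · rw [detourMajorant_of_neg hl0]
    exact h.sum_div_le
  obtain rfl | rfl : l = 0 ∨ l = 1 := by lia
  · rw [detourMajorant_of_mem le_rfl (by lia), monotoneMajorant_zero]
    simp [greenSum]
  · have hn : (1 : ℤ) < n := by lia
    have hrec := vertexGap_mul_monotoneMajorant (b := b) (B := B) one_pos hn
    rw [sub_self, monotoneMajorant_zero, monotoneMajorant_of_neg (l := 1 - 2) (by lia),
      vertexGap] at hrec
    push_cast at hrec
    have h3' : (3 : ℝ) ≤ n := mod_cast h3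
    have := h.sum_le
    have := h.B_nonneg
    have := h.a_nonneg
    have := h.A_nonneg
    refine (h.le_two_mul zero_le_one hn).trans ?_
    nlinarith

theorem add_one_le (h0 : 0 ≤ l) (hn : l < n) : detourMajorant b B a A M n (l + 1)
    ≤ 2 * (growthBound b B * monotoneMajorant b B n l) := by
  rcases (Int.add_one_le_of_lt hn).eq_or_lt with hl | hl
  · refine (h.le_two_mul_of_le (by lia)).trans ?_
    rw [show (n : ℤ) - 1 = l by lia]
    gcongr
    exact le_mul_of_one_le_left (h.monotoneMajorant_nonneg l) h.growthBound_ge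
  · refine (h.le_two_mul (by lia) hl).trans ?_
    gcongr
    exact monotoneMajorant_add_one_le h.b_pos h.B_nonneg h0 hl

theorem add_two_le (h0 : 0 ≤ l) (hn : l < n) : detourMajorant b B a A M n (l + 2)
    ≤ 2 * (growthBound b B ^ 2 * monotoneMajorant b B n l) := by
  have hρ := h.growthBound_ge
  rcases (Int.add_one_le_of_lt hn).eq_or_lt with hl | hl
  · refine (h.le_two_mul_of_le (by lia)).trans ?_
    rw [show (n : ℤ) - 1 = l by lia]
    gcongr
    exact le_mul_of_one_le_left (h.monotoneMajorant_nonneg l) (one_le_pow₀ hρ)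
  · rw [show l + 2 = l + 1 + 1 by lia, pow_two, mul_assoc]
    refine (h.add_one_le (by lia) hl).trans ?_
    gcongr
    exact monotoneMajorant_add_one_le h.b_pos h.B_nonneg h0 hl

theorem sub_two_le (h0 : 2 ≤ l) (hn : l ≤ n) : detourMajorant b B a A M n (l - 2)
    ≤ (1 + M * greenSum n (l - 1)) * monotoneMajorant b B n (l - 2) := by
  rw [detourMajorant_of_mem (by lia) (by lia)]
  exact mul_le_mul_of_nonneg_right (h.factor_mono (by lia)) (h.monotoneMajorant_nonneg _)

theorem mul_sub_two_le (h0 : 0 < l) (hn : l < n) : B * detourMajorant b B a A M n (l - 2)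
    ≤ (1 + M * greenSum n (l - 1)) * (B * monotoneMajorant b B n (l - 2))
      + 4 * B * (b + B + a + A) / b * monotoneMajorant b B n l := by
  have hb := h.b_pos
  have hB := h.B_nonneg
  have hS := h.sum_pos
  have hu := h.monotoneMajorant_nonneg l
  obtain rfl | h2 : l = 1 ∨ 2 ≤ l := by lia
  · have h3 : (3 : ℝ) ≤ n := mod_cast h.three_le
    have hone := mul_monotoneMajorant_sub_one_le hb.le hB one_pos hn
    rw [sub_self, monotoneMajorant_zero, mul_one, vertexGap, mul_one] at hone
    push_cast at hone
    rw [detourMajorant_of_neg (by lia), monotoneMajorant_of_neg (l := 1 - 2) (by lia)]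
    calc B * ((b + B + a + A) / n) = B * (b + B + a + A) / b / n * b := by field
      _ ≤ B * (b + B + a + A) / b / n * (4 * n * monotoneMajorant b B n 1) := by
          gcongr
          nlinarith
      _ = _ := by field
  · rw [mul_left_comm]
    have := mul_le_mul_of_nonneg_left (h.sub_two_le h2 hn.le) hB
    have : 0 ≤ 4 * B * (b + B + a + A) / b * monotoneMajorant b B n l := by positivity
    linarith

theorem supersolution_inside (h0 : 0 < l) (hn : l < n) :
    b * detourMajorant b B a A M n (l - 1) + B * detourMajorant b B a A M n (l - 2)
        + a * detourMajorant b B a A M n (l + 1) + A * detourMajorant b B a A M n (l + 2)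
      ≤ (vertexGap n l - 1) * detourMajorant b B a A M n l := by
  have hb := mul_detourMajorant_sub_one (b := b) (B := B) (a := a) (A := A) (M := M) h0 hn.le
  have hB := h.mul_sub_two_le h0 hn
  have ha := mul_le_mul_of_nonneg_left (h.add_one_le h0.le hn) h.a_nonneg
  have hA := mul_le_mul_of_nonneg_left (h.add_two_le h0.le hn) h.A_nonneg
  have hrec := vertexGap_mul_monotoneMajorant (b := b) (B := B) h0 hn
  have hgap : (0 : ℝ) < vertexGap n l := mod_cast vertexGap_pos h0 hn
  have hgreen := greenSum_add_one (by lia : 0 ≤ l - 1) (by lia : l - 1 + 1 < n)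
  rw [sub_add_cancel] at hgreen
  set u := monotoneMajorant b B n
  set P := 1 + M * greenSum n (l - 1)
  have hu : 0 ≤ u l := h.monotoneMajorant_nonneg l
  -- Passing from `l - 1` to `l` increases `greenSum` by exactly the reciprocal of the gap, so the
  -- correction gains `M * u l`, which pays for the detours.
  have hgain : (vertexGap n l - 1) * detourMajorant b B a A M n l
      = P * (vertexGap n l * u l) + (M - (1 + M * greenSum n l)) * u l := by
    rw [detourMajorant_of_mem h0.le hn, hgreen]
    simp only [P]
    field
  rw [hgain, hrec]
  have hM := mul_le_mul_of_nonneg_right h.le_M hu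
  have htwo := mul_le_mul_of_nonneg_right (h.factor_le_two hn) hu
  linarith

theorem supersolution_outside (hl : l < 0 ∨ n ≤ l) :
    vertexMajorant n l
        * (b * detourMajorant b B a A M n (l - 1) + B * detourMajorant b B a A M n (l - 2)
          + a * detourMajorant b B a A M n (l + 1) + A * detourMajorant b B a A M n (l + 2))
      ≤ detourMajorant b B a A M n l := by
  have h3 := h.three_le
  rcases eq_or_ne l n with rfl | hne
  · simpa [vertexMajorant, vertexGap] using h.nonneg n
  have hD := vertexMajorant_le_inv (by lia) hl
  have hb := h.b_pos.le
  have hB := h.B_nonneg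
  have ha := h.a_nonneg
  have hA := h.A_nonneg
  obtain ⟨Φ, hΦ, hle, heq⟩ : ∃ Φ, 0 ≤ Φ ∧ (∀ k, l - 2 ≤ k → k ≤ l + 2 →
      detourMajorant b B a A M n k ≤ Φ) ∧
      (n : ℝ)⁻¹ * ((b + B + a + A) * Φ) = detourMajorant b B a A M n l := by
    rcases hl with hl | hl
    · exact ⟨1, zero_le_one, fun k _ _ => h.le_one (by lia),
        by rw [detourMajorant_of_neg hl]; ring⟩
    · exact ⟨2 * monotoneMajorant b B n (n - 1),
        mul_nonneg zero_le_two (h.monotoneMajorant_nonneg _),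
        fun k _ _ => h.le_two_mul_of_le (by lia), by rw [detourMajorant_of_le hl]; ring⟩
  rw [← heq]
  calc _ ≤ (n : ℝ)⁻¹ * (b * Φ + B * Φ + a * Φ + A * Φ) := by
        refine mul_le_mul_of_nonneg hD ?_ (vertexMajorant_nonneg n l) (by positivity)
        gcongr <;> apply hle <;> lia
    _ = (n : ℝ)⁻¹ * ((b + B + a + A) * Φ) := by ring

theorem isSupersolution :
    IsSupersolution hillSteps (stepWeight b B a A) (vertexMajorant n)
      (detourMajorant b B a A M n) := by
  have h3 := h.three_le
  refine ⟨h.nonneg, fun l => ?_⟩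
  rw [sum_hillSteps]
  rcases eq_or_ne l 0 with rfl | hl
  · rw [detourMajorant_of_mem le_rfl (by lia), monotoneMajorant_zero]
    simp [vertexMajorant, vertexGap_zero, greenSum]
  rw [if_neg hl, zero_add]
  by_cases hout : l < 0 ∨ n ≤ l
  · exact h.supersolution_outside hout
  · have h0 : 0 < l := by lia
    have hn : l < n := by lia
    have hgap : (1 : ℝ) < vertexGap n l := by
      exact_mod_cast (by unfold vertexGap; nlinarith : 1 < vertexGap n l)
    rw [vertexMajorant_of_lt h0 hn, inv_mul_le_iff₀ (by linarith)]
    exact h.supersolution_inside h0 hn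

theorem sum_hillSteps_le :
    ∑ m ∈ hillSteps, stepWeight b B a A m * detourMajorant b B a A M n (n - m)
      ≤ (b * monotoneMajorant b B n (n - 1) + B * monotoneMajorant b B n (n - 2))
        * (1 + (M + 2 * (b + B + a + A) * (a + A) / b) * (Real.log n / n)) := by
  have h3 := h.three_le
  have hb := h.b_pos
  have hS := h.sum_pos
  have ha := h.a_nonneg
  have hA := h.A_nonneg
  have hu := h.monotoneMajorant_nonneg
  rw [sum_hillSteps, mul_detourMajorant_sub_one (by lia) le_rfl,
    detourMajorant_of_le (by lia : (n : ℤ) ≤ n + 1),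
    detourMajorant_of_le (by lia : (n : ℤ) ≤ n + 2)]
  have hBterm := mul_le_mul_of_nonneg_left (h.sub_two_le (l := n) (by lia) le_rfl) h.B_nonneg
  have hgreen := greenSum_le_log h3
  have hlog := inv_le_log_div h3
  set u := monotoneMajorant b B n
  set S := b + B + a + A
  set T := b * u (n - 1) + B * u (n - 2)
  have huT : u (n - 1) ≤ T / b := by
    rw [le_div_iff₀' hb]
    exact le_add_of_nonneg_right (mul_nonneg h.B_nonneg (hu _))
  have hT : 0 ≤ T := add_nonneg (mul_nonneg hb.le (hu _)) (mul_nonneg h.B_nonneg (hu _))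
  have hM := h.M_nonneg
  calc _ ≤ (1 + M * greenSum n (n - 1)) * T + 2 * S * (a + A) * (n : ℝ)⁻¹ * u (n - 1) := by
        linear_combination hBterm
    _ ≤ (1 + M * (Real.log n / n)) * T + 2 * S * (a + A) * (Real.log n / n) * (T / b) := by
        gcongr
        exact hu _
    _ = _ := by ring

end DetourRegime

theorem exists_detourRegime (hb : 0 < b) (hB : 0 ≤ B) (ha : 0 ≤ a) (hA : 0 ≤ A) :
    ∃ M, ∀ᶠ n : ℕ in Filter.atTop, DetourRegime b B a A M n := by
  set M := 2 + 2 * (a * growthBound b B + A * growthBound b B ^ 2) + 4 * B * (b + B + a + A) / b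
  have hM : 0 ≤ M := by
    have := one_le_growthBound hb hB
    positivity
  have hlim : Filter.Tendsto (fun n : ℕ => M * (Real.log n / n)) Filter.atTop (nhds (M * 0)) :=
    (Real.isLittleO_log_id_atTop.tendsto_div_nhds_zero.comp
      tendsto_natCast_atTop_atTop).const_mul M
  rw [mul_zero] at hlim
  refine ⟨M, ?_⟩
  filter_upwards [Filter.eventually_ge_atTop 3, hlim.eventually_le_const zero_lt_one,
    tendsto_natCast_atTop_atTop.eventually_ge_atTop (b + B + a + A)] with n h3 hlog hsum
  exact ⟨hb, hB, ha, hA, h3, hsum, le_rfl,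
    (mul_le_mul_of_nonneg_left (greenSum_le_log h3) hM).trans hlog⟩

end Supersolutions

section ClosedForm

open PowerSeries

/-- The derivation `x d/dx` of the ring of formal power series. -/
noncomputable def eulerOperator (R : Type*) [CommRing R] : Derivation R R⟦X⟧ R⟦X⟧ :=
  (X : R⟦X⟧) • d⁄dX R

/-- The differential operator `4ϑ(n - ϑ) - bx - Bx²`, with `ϑ = x d/dx`; its coefficients express
the recurrence of `monotoneSum b B` with the vertex weights `1 / (4l(n - l))`. -/
noncomputable def walkOperator {R : Type*} [CommRing R] (b B : R) (n : ℕ) (f : R⟦X⟧) : R⟦X⟧ :=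
  4 * eulerOperator R (n * f - eulerOperator R f) - C b * X * f - C B * X ^ 2 * f

/-- The conjugate of `walkOperator` by an exponential series: a differential operator of
confluent hypergeometric type, with two-term recurrences for the coefficients. -/
noncomputable def kummerOperator {R : Type*} [CommRing R] (σ c : R) (n : ℕ) (g : R⟦X⟧) : R⟦X⟧ :=
  4 * eulerOperator R (n * g - eulerOperator R g) - 8 * C c * X * eulerOperator R g
    + 4 * C (c * (n - 1 + σ)) * X * g

section Operators

variable {R : Type*} [CommRing R]

theorem coeff_eulerOperator (f : R⟦X⟧) (k : ℕ) :
    coeff k (eulerOperator R f) = k * coeff k f := by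
  have : eulerOperator R f = X * d⁄dX R f := rfl
  cases k with
  | zero => simp [this]
  | succ k => rw [this, coeff_succ_X_mul, coeff_derivative]; push_cast; ring

theorem coeff_walkOperator (b B : R) (n : ℕ) (f : R⟦X⟧) (k : ℕ) :
    coeff k (walkOperator b B n f) = 4 * k * (n - k) * coeff k f
      - b * (if 1 ≤ k then coeff (k - 1) f else 0)
      - B * (if 2 ≤ k then coeff (k - 2) f else 0) := by
  have h4 : (4 : R⟦X⟧) = C 4 := (map_ofNat C 4).symm
  have hn : (n : R⟦X⟧) = C (n : R) := (map_natCast C n).symm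
  rw [walkOperator, mul_assoc, mul_assoc, h4, hn, ← pow_one X]
  simp only [map_sub, coeff_C_mul, coeff_eulerOperator, ← pow_mul, one_mul, coeff_X_pow_mul']
  ring

theorem coeff_zero_kummerOperator (σ c : R) (n : ℕ) (g : R⟦X⟧) :
    coeff 0 (kummerOperator σ c n g) = 0 := by
  have h (f : R⟦X⟧) : constantCoeff (eulerOperator R f) = 0 := by
    simpa using coeff_eulerOperator f 0
  simp [kummerOperator, h]

theorem coeff_succ_kummerOperator (σ c : R) (n : ℕ) (g : R⟦X⟧) (k : ℕ) :
    coeff (k + 1) (kummerOperator σ c n g)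
      = 4 * ((k + 1) * (n - (k + 1)) * coeff (k + 1) g - c * (2 * k + 1 - n - σ) * coeff k g) := by
  have h4 : (4 : R⟦X⟧) = C 4 := (map_ofNat C 4).symm
  have h8 : (8 : R⟦X⟧) = C 8 := (map_ofNat C 8).symm
  have hn : (n : R⟦X⟧) = C (n : R) := (map_natCast C n).symm
  rw [kummerOperator, h4, h8, hn]
  simp only [map_sub, map_add, mul_assoc, coeff_C_mul, coeff_succ_X_mul, coeff_eulerOperator]
  push_cast
  ring

theorem walkOperator_mul {E : R⟦X⟧} {c : R} (hE : eulerOperator R E = C c * X * E) (σ : R) (n : ℕ)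
    (g : R⟦X⟧) : walkOperator (-(4 * σ * c)) (-(4 * c ^ 2)) n (E * g)
      = E * kummerOperator σ c n g := by
  have hX : eulerOperator R (X : R⟦X⟧) = X := by simp [eulerOperator]
  have hC : eulerOperator R (C c) = 0 := by simp [eulerOperator]
  have hθ (f : R⟦X⟧) : eulerOperator R (E * f) = E * (eulerOperator R f + C c * X * f) := by
    rw [Derivation.leibniz, hE]
    simp only [smul_eq_mul]
    ring
  have hCX (f : R⟦X⟧) : eulerOperator R (C c * X * f)
      = C c * X * (f + eulerOperator R f) := by
    simp only [Derivation.leibniz, hX, hC, smul_eq_mul]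
    ring
  have hfactor : (n : R⟦X⟧) * (E * g) - eulerOperator R (E * g)
      = E * ((n : R⟦X⟧) * g - eulerOperator R g - C c * X * g) := by
    rw [hθ]
    ring
  have h4 : (C 4 : R⟦X⟧) = 4 := map_ofNat C 4
  rw [walkOperator, kummerOperator, hfactor, hθ, map_sub, hCX]
  simp only [map_neg, map_mul, map_pow, map_sub, map_add, map_natCast, map_one, h4]
  ring

theorem monotoneSum_eq_coeff {K : Type*} [Field K] [CharZero K] {b B : K} {n : ℕ} {d : ℤ → K}
    (hd : ∀ l : ℤ, 0 < l → l < n → d l = (vertexGap n l : K)⁻¹) {f : K⟦X⟧} (hf₀ : coeff 0 f = 1)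
    (hf : ∀ k < n, coeff k (walkOperator b B n f) = 0) (k : ℕ) (hk : k < n) :
    monotoneSum b B d k = coeff k f := by
  induction k using Nat.strong_induction_on with
  | _ k ih =>
    obtain rfl | (hpos : 1 ≤ k) := Nat.eq_zero_or_pos k
    · rw [Nat.cast_zero, monotoneSum_zero, hf₀]
    have hgap : (vertexGap n k : K) = 4 * k * (n - k) := by simp [vertexGap]
    have hgap₀ : (vertexGap n k : K) ≠ 0 := by
      exact_mod_cast (vertexGap_pos (by lia : (0 : ℤ) < k) (by lia)).ne'
    have htwo : monotoneSum b B d (k - 2 : ℤ) = if 2 ≤ k then coeff (k - 2) f else 0 := by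
      split_ifs with h
      · rw [← ih (k - 2) (by lia) (by lia), Nat.cast_sub h, Nat.cast_ofNat]
      · exact monotoneSum_of_neg _ _ _ (by lia)
    have hrec := hf k hk
    rw [coeff_walkOperator, if_pos hpos, ← htwo, ← ih (k - 1) (by lia) (by lia), ← hgap,
      Nat.cast_sub hpos, Nat.cast_one] at hrec
    rw [monotoneSum_of_pos _ _ _ (by lia), hd k (by lia) (by lia), inv_mul_eq_iff_eq_mul₀ hgap₀]
    linear_combination -hrec

theorem monotoneSum_last {K : Type*} [Field K] [CharZero K] {b B : K} {n : ℕ} (hn : 1 ≤ n)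
    {d : ℤ → K} (hd : ∀ l : ℤ, 0 < l → l < n → d l = (vertexGap n l : K)⁻¹) {f : K⟦X⟧}
    (hf₀ : coeff 0 f = 1) (hf : ∀ k < n, coeff k (walkOperator b B n f) = 0) :
    b * monotoneSum b B d (n - 1) + B * monotoneSum b B d (n - 2)
      = -coeff n (walkOperator b B n f) := by
  have hcoeff := monotoneSum_eq_coeff hd hf₀ hf
  have hone : monotoneSum b B d (n - 1 : ℤ) = coeff (n - 1) f := by
    rw [← hcoeff (n - 1) (by lia), Nat.cast_sub hn, Nat.cast_one]
  have htwo : monotoneSum b B d (n - 2 : ℤ) = if 2 ≤ n then coeff (n - 2) f else 0 := by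
    split_ifs with h
    · rw [← hcoeff (n - 2) (by lia), Nat.cast_sub h, Nat.cast_ofNat]
    · exact monotoneSum_of_neg _ _ _ (by lia)
  rw [coeff_walkOperator, if_pos hn, hone, htwo, sub_self]
  ring

end Operators

section Kummer

variable {K : Type*} [Field K]

/-- The coefficients, below degree `n`, of the confluent hypergeometric series by which
`walkOperator` is solved; they vanish from degree `n` on because of the factor `1 / 0 = 0`. -/
def kummerCoeff (σ c : K) (n k : ℕ) : K :=
  ∏ i ∈ Finset.range k, c * (2 * i + 1 - n - σ) / ((i + 1) * (n - (i + 1)))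

theorem kummerCoeff_succ [CharZero K] (σ c : K) {n k : ℕ} (hk : k + 1 ≠ n) :
    (k + 1) * (n - (k + 1)) * kummerCoeff σ c n (k + 1)
      = c * (2 * k + 1 - n - σ) * kummerCoeff σ c n k := by
  have h1 : (k + 1 : K) ≠ 0 := Nat.cast_add_one_ne_zero k
  have h2 : (n - (k + 1) : K) ≠ 0 := sub_ne_zero.2 (mod_cast hk.symm)
  rw [kummerCoeff, Finset.prod_range_succ, ← kummerCoeff]
  field

theorem kummerCoeff_last [CharZero K] (σ c : K) (n : ℕ) :
    kummerCoeff σ c (n + 1) n * (c * (n - σ))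
      = (∏ i ∈ Finset.range (n + 1), c * (2 * i - n - σ)) / (n.factorial : K) ^ 2 := by
  have hleft : ∏ i ∈ Finset.range n, (i + 1 : K) = n.factorial :=
    mod_cast Finset.prod_range_add_one_eq_factorial n
  have hright : ∏ i ∈ Finset.range n, ((n + 1 : ℕ) - (i + 1) : K) = n.factorial := by
    rw [← hleft, ← Finset.prod_range_reflect]
    refine Finset.prod_congr rfl fun i hi => ?_
    rw [Finset.mem_range] at hi
    rw [show n - 1 - i = n - (i + 1) by lia, Nat.cast_sub (by lia)]
    push_cast
    ring
  have hnum (i : ℕ) : (2 * i + 1 - (n + 1 : ℕ) - σ : K) = 2 * i - n - σ := by push_cast; ring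
  rw [Finset.prod_range_succ, kummerCoeff, Finset.prod_div_distrib,
    Finset.prod_mul_distrib (f := fun i : ℕ => (i + 1 : K)), hleft, hright]
  simp only [hnum]
  ring

theorem exists_coeff_walkOperator_eq_zero [CharZero K] (σ c : K) (n : ℕ) :
    ∃ f : K⟦X⟧, coeff 0 f = 1 ∧
      (∀ k < n + 1, coeff k (walkOperator (-(4 * σ * c)) (-(4 * c ^ 2)) (n + 1) f) = 0) ∧
      coeff (n + 1) (walkOperator (-(4 * σ * c)) (-(4 * c ^ 2)) (n + 1) f)
        = -(4 * (kummerCoeff σ c (n + 1) n * (c * (n - σ)))) := by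
  set E : K⟦X⟧ := PowerSeries.mk fun k => c ^ k / (k.factorial : K)
  set g := PowerSeries.mk (kummerCoeff σ c (n + 1))
  have hE : eulerOperator K E = C c * X * E := by
    ext k
    rw [coeff_eulerOperator, mul_assoc, coeff_C_mul]
    cases k with
    | zero => simp
    | succ k =>
      have := Nat.cast_add_one_ne_zero (R := K) k
      rw [coeff_succ_X_mul, coeff_mk, coeff_mk, Nat.factorial_succ]
      push_cast
      field
  obtain ⟨r, hr⟩ : X ^ (n + 1) ∣ kummerOperator σ c (n + 1) g := by
    refine X_pow_dvd_iff.2 fun k hk => ?_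
    cases k with
    | zero => exact coeff_zero_kummerOperator σ c _ _
    | succ k =>
      rw [coeff_succ_kummerOperator, coeff_mk, coeff_mk, kummerCoeff_succ σ c (by lia), sub_self,
        mul_zero]
  have hlast : coeff 0 r = -(4 * (kummerCoeff σ c (n + 1) n * (c * (n - σ)))) := by
    have := coeff_succ_kummerOperator σ c (n + 1) g n
    rw [hr, coeff_X_pow_mul', if_pos le_rfl, Nat.sub_self, coeff_mk, coeff_mk] at this
    rw [this]
    push_cast
    ring
  have hWf : walkOperator (-(4 * σ * c)) (-(4 * c ^ 2)) (n + 1) (E * g)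
      = X ^ (n + 1) * (E * r) := by
    rw [walkOperator_mul hE, hr, mul_left_comm]
  refine ⟨E * g, ?_, fun k hk => ?_, ?_⟩
  · simp [E, g, kummerCoeff]
  · rw [hWf, coeff_X_pow_mul', if_neg hk.not_ge]
  · rw [hWf, coeff_X_pow_mul', if_pos le_rfl, Nat.sub_self, ← hlast]
    simp [E]

theorem monotoneSum_last_eq_prod [CharZero K] (σ c : K) (n : ℕ) {d : ℤ → K}
    (hd : ∀ l : ℤ, 0 < l → l < (n + 1 : ℕ) → d l = (vertexGap (n + 1 : ℕ) l : K)⁻¹) :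
    -(4 * σ * c) * monotoneSum (-(4 * σ * c)) (-(4 * c ^ 2)) d ((n + 1 : ℕ) - 1)
      + -(4 * c ^ 2) * monotoneSum (-(4 * σ * c)) (-(4 * c ^ 2)) d ((n + 1 : ℕ) - 2)
      = 4 * ((∏ i ∈ Finset.range (n + 1), c * (2 * i - n - σ)) / (n.factorial : K) ^ 2) := by
  obtain ⟨f, hf₀, hf, hlast⟩ := exists_coeff_walkOperator_eq_zero σ c n
  rw [monotoneSum_last (by lia) hd hf₀ hf, hlast, neg_neg, kummerCoeff_last]

end Kummer

section EulerProduct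

open scoped Nat

/-- The partial products of the Euler products for `cos (π σ / 2)` (at even `n`) and
`I * (2 / π) * sin (π σ / 2)` (at odd `n`). -/
noncomputable def eulerProd (σ : ℂ) : ℕ → ℂ
  | 0 => 1
  | 1 => Complex.I * σ
  | n + 2 => eulerProd σ n * (1 - σ ^ 2 / (n + 1) ^ 2)

/-- The factor that carries the growth of the sums over the walks. -/
noncomputable def leadingFactor (β : ℂ) (n : ℕ) : ℂ :=
  4 * (Complex.I * β / 2) ^ n / ((n - 2)‼ : ℂ) ^ 2

theorem prod_two_mul_sub (σ : ℂ) (n : ℕ) : ∏ i ∈ Finset.range (n + 1), (2 * i - n - σ)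
    = Complex.I ^ (n + 1) * (n ‼ : ℂ) ^ 2 * eulerProd σ (n + 1) := by
  induction n using Nat.twoStepInduction with
  | zero => simp [eulerProd, ← mul_assoc]
  | one =>
    simp only [Finset.prod_range_succ, Finset.prod_range_zero, eulerProd, Nat.doubleFactorial]
    push_cast
    linear_combination -(1 - σ ^ 2) * Complex.I_sq
  | more n ih _ =>
    have hn : (n + 2 : ℂ) ≠ 0 := mod_cast (n + 1).succ_ne_zero
    have hshift (i : ℕ) : (2 * (i + 1 : ℕ) - (n + 2 : ℕ) - σ : ℂ) = 2 * i - n - σ := by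
      push_cast
      ring
    rw [Finset.prod_range_succ, Finset.prod_range_succ']
    simp only [hshift]
    rw [ih, eulerProd, Nat.doubleFactorial_add_two]
    push_cast
    rw [show (n : ℂ) + 1 + 1 = n + 2 by ring, show n + 2 + 1 = n + 1 + 2 by ring,
      pow_add _ (n + 1), Complex.I_sq]
    field

theorem monotoneSum_last_eq_leadingFactor (σ β : ℂ) {n : ℕ} (hn : 1 ≤ n) {d : ℤ → ℂ}
    (hd : ∀ l : ℤ, 0 < l → l < n → d l = (vertexGap n l : ℂ)⁻¹) :
    -2 * σ * β * monotoneSum (-2 * σ * β) (-β ^ 2) d (n - 1)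
      + -β ^ 2 * monotoneSum (-2 * σ * β) (-β ^ 2) d (n - 2)
      = leadingFactor β n * eulerProd σ n := by
  obtain ⟨n, rfl⟩ := Nat.exists_eq_add_of_le' hn
  have hfac : (n ! : ℂ) = n ‼ * (n - 1)‼ := by
    cases n with
    | zero => simp
    | succ n => exact_mod_cast n.factorial_eq_mul_doubleFactorial
  have hne : (n ‼ : ℂ) ≠ 0 := mod_cast n.doubleFactorial_pos.ne'
  have hb : -2 * σ * β = -(4 * σ * (β / 2)) := by ring
  have hB : -β ^ 2 = -(4 * (β / 2) ^ 2) := by ring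
  rw [hb, hB, monotoneSum_last_eq_prod σ (β / 2) n hd, Finset.prod_mul_distrib, prod_two_mul_sub,
    Finset.prod_const, Finset.card_range, hfac, leadingFactor, show n + 1 - 2 = n - 1 by lia]
  field

end EulerProduct

end ClosedForm

section EulerLimit

open Filter Topology

/-- The limit of `eulerProd σ` along the integers of the parity of `n`. -/
noncomputable def eulerLimit (σ : ℂ) (n : ℕ) : ℂ :=
  if Even n then Complex.cos (Real.pi * σ / 2)
  else Complex.I * (2 / Real.pi * Complex.sin (Real.pi * σ / 2))

/-- The partial products of Euler's product for `sin (π x)`. -/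
noncomputable def sineProd (x : ℂ) (m : ℕ) : ℂ :=
  Real.pi * x * ∏ j ∈ Finset.range m, (1 - x ^ 2 / ((j : ℂ) + 1) ^ 2)

theorem sineProd_succ (x : ℂ) (m : ℕ) :
    sineProd x (m + 1) = sineProd x m * (1 - x ^ 2 / ((m : ℂ) + 1) ^ 2) := by
  rw [sineProd, sineProd, Finset.prod_range_succ, mul_assoc, mul_assoc, mul_assoc]

theorem eulerProd_odd (σ : ℂ) (m : ℕ) :
    eulerProd σ (2 * m + 1) = Complex.I * (2 / Real.pi * sineProd (σ / 2) m) := by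
  have hpi : (Real.pi : ℂ) ≠ 0 := mod_cast Real.pi_ne_zero
  induction m with
  | zero =>
    simp only [eulerProd, sineProd, Finset.range_zero, Finset.prod_empty]
    field
  | succ m ih =>
    have hm : (m + 1 : ℂ) ≠ 0 := Nat.cast_add_one_ne_zero m
    rw [show 2 * (m + 1) + 1 = 2 * m + 1 + 2 by ring, eulerProd, ih, sineProd_succ]
    push_cast
    rw [show (2 * m + 1 + 1 : ℂ) = 2 * (m + 1) by ring]
    field

/-- This expresses `cos (π σ / 2) = sin (π (σ + 1) / 2) / sin (π / 2)` for the partial products. -/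
theorem eulerProd_even_mul_sineProd (σ : ℂ) (m : ℕ) :
    eulerProd σ (2 * m) * (sineProd (1 / 2) m * (1 + σ / (2 * m + 1)))
      = sineProd ((σ + 1) / 2) m := by
  induction m with
  | zero =>
    simp only [eulerProd, sineProd, Finset.range_zero, Finset.prod_empty]
    push_cast
    field
  | succ m ih =>
    have hm : (m + 1 : ℂ) ≠ 0 := Nat.cast_add_one_ne_zero m
    have hodd : (2 * m + 1 : ℂ) ≠ 0 := mod_cast (2 * m).succ_ne_zero
    have hodd' : (2 * m + 3 : ℂ) ≠ 0 := mod_cast (2 * m + 2).succ_ne_zero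
    rw [sineProd_succ, sineProd_succ, ← ih, show 2 * (m + 1) = 2 * m + 2 by ring, eulerProd]
    push_cast
    rw [show (2 * (m + 1) + 1 : ℂ) = 2 * m + 3 by ring]
    field

theorem tendsto_sineProd (x : ℂ) :
    Tendsto (sineProd x) atTop (𝓝 (Complex.sin (Real.pi * x))) :=
  Complex.tendsto_euler_sin_prod x

theorem tendsto_eulerProd_odd (σ : ℂ) : Tendsto (fun m => eulerProd σ (2 * m + 1)) atTop
    (𝓝 (Complex.I * (2 / Real.pi * Complex.sin (Real.pi * σ / 2)))) := by
  simp_rw [eulerProd_odd, mul_div_assoc]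
  exact ((tendsto_sineProd (σ / 2)).const_mul _).const_mul _

theorem tendsto_eulerProd_even (σ : ℂ) :
    Tendsto (fun m => eulerProd σ (2 * m)) atTop (𝓝 (Complex.cos (Real.pi * σ / 2))) := by
  have hcos : Complex.sin (Real.pi * ((σ + 1) / 2)) = Complex.cos (Real.pi * σ / 2) := by
    rw [← Complex.sin_add_pi_div_two]
    congr 1
    ring
  have hone : Tendsto (fun m : ℕ => sineProd (1 / 2) m * (1 + σ / (2 * m + 1))) atTop (𝓝 1) := by
    have hsin := tendsto_sineProd (1 / 2)
    rw [mul_one_div, Complex.sin_pi_div_two] at hsin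
    have hquot : Tendsto (fun m : ℕ => 1 + σ / (2 * (m : ℂ) + 1)) atTop (𝓝 (1 + 0)) := by
      have hatTop : Tendsto (fun m => 2 * m + 1) atTop (atTop : Filter ℕ) :=
        tendsto_atTop_mono (fun m => by simp only [id]; lia) tendsto_id
      have := (tendsto_const_div_atTop_nhds_zero_nat σ).comp hatTop
      exact_mod_cast this.const_add 1
    simpa using hsin.mul hquot
  have hquot := (tendsto_sineProd ((σ + 1) / 2)).div hone one_ne_zero
  rw [hcos, div_one] at hquot
  refine hquot.congr' ?_
  filter_upwards [hone.eventually_ne one_ne_zero] with m hm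
  rw [Pi.div_apply, ← eulerProd_even_mul_sineProd, mul_div_cancel_right₀ _ hm]

theorem tendsto_eulerProd (σ : ℂ) (n : ℕ) :
    Tendsto (fun j => eulerProd σ (n + 2 * j)) atTop (𝓝 (eulerLimit σ n)) := by
  obtain ⟨k, rfl | rfl⟩ := n.even_or_odd'
  · rw [eulerLimit, if_pos (even_two_mul k)]
    refine ((tendsto_eulerProd_even σ).comp (tendsto_add_atTop_nat k)).congr fun j => ?_
    rw [Function.comp_apply, mul_add, add_comm]
  · rw [eulerLimit, if_neg (by simp)]
    refine ((tendsto_eulerProd_odd σ).comp (tendsto_add_atTop_nat k)).congr fun j => ?_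
    rw [Function.comp_apply, mul_add, add_comm (2 * j), add_right_comm]

theorem exists_norm_eulerProd_le (σ : ℂ) : ∃ K, ∀ n, ‖eulerProd σ n‖ ≤ K := by
  obtain ⟨K₀, h₀⟩ := (Metric.isBounded_range_of_tendsto _ (tendsto_eulerProd_even σ)).exists_norm_le
  obtain ⟨K₁, h₁⟩ := (Metric.isBounded_range_of_tendsto _ (tendsto_eulerProd_odd σ)).exists_norm_le
  rw [Set.forall_mem_range] at h₀ h₁
  refine ⟨max K₀ K₁, fun n => ?_⟩
  obtain ⟨k, rfl | rfl⟩ := n.even_or_odd'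
  · exact (h₀ k).trans (le_max_left _ _)
  · exact (h₁ k).trans (le_max_right _ _)

theorem dist_limit_le_of_dist_le_sub {α : Type*} [PseudoMetricSpace α] {p : ℕ → α} {P : α}
    (hp : Tendsto p atTop (𝓝 P)) {e : ℕ → ℝ} (he : ∀ j, 0 ≤ e j)
    (hdist : ∀ j, dist (p j) (p (j + 1)) ≤ e j - e (j + 1)) : dist (p 0) P ≤ e 0 := by
  refine le_of_tendsto (tendsto_const_nhds.dist hp) (Eventually.of_forall fun m => ?_)
  calc dist (p 0) (p m) ≤ ∑ j ∈ Finset.range m, (e j - e (j + 1)) :=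
        dist_le_range_sum_of_dist_le m fun _ => hdist _
    _ = e 0 - e m := Finset.sum_range_sub' e m
    _ ≤ e 0 := sub_le_self _ (he m)

theorem exists_norm_eulerProd_sub_eulerLimit_le (σ : ℂ) :
    ∃ C, ∀ n : ℕ, 1 ≤ n → ‖eulerProd σ n - eulerLimit σ n‖ ≤ C / n := by
  obtain ⟨K, hK⟩ := exists_norm_eulerProd_le σ
  have hK₀ : 0 ≤ K := (norm_nonneg _).trans (hK 0)
  refine ⟨K * ‖σ‖ ^ 2 / 2, fun n hn => ?_⟩
  have hbound := dist_limit_le_of_dist_le_sub (tendsto_eulerProd σ n)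
    (e := fun j => K * ‖σ‖ ^ 2 / 2 / (n + 2 * j : ℕ)) (fun j => by positivity) fun j => ?_
  · simpa [dist_eq_norm] using hbound
  set x : ℝ := ↑(n + 2 * j) with hx
  have : 1 ≤ x := Nat.one_le_cast.2 (by lia)
  have hsucc : ((n + 2 * (j + 1) : ℕ) : ℝ) = x + 2 := by rw [hx]; push_cast; ring
  have hnorm : ‖((n + 2 * j : ℕ) + 1 : ℂ)‖ = x + 1 := by
    rw [← Nat.cast_succ, Complex.norm_natCast, Nat.cast_succ]
  have htelescope : 1 / (x + 1) ^ 2 ≤ 1 / 2 * (1 / x - 1 / (x + 2)) := by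
    rw [show 1 / 2 * (1 / x - 1 / (x + 2)) = 1 / (x * (x + 2)) by field]
    gcongr
    linarith
  calc dist (eulerProd σ (n + 2 * j)) (eulerProd σ (n + 2 * (j + 1)))
      = ‖eulerProd σ (n + 2 * j)‖ * (‖σ‖ ^ 2 * (1 / (x + 1) ^ 2)) := by
        rw [dist_eq_norm, show n + 2 * (j + 1) = n + 2 * j + 2 by ring, eulerProd, mul_one_sub,
          sub_sub_cancel, norm_mul, norm_div, norm_pow, norm_pow, hnorm]
        ring
    _ ≤ K * (‖σ‖ ^ 2 * (1 / 2 * (1 / x - 1 / (x + 2)))) := by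
        gcongr
        exact hK _
    _ = _ := by
        rw [hsucc]
        ring

section Nonvanishing

variable {σ : ℂ}

theorem sin_half_pi_mul_ne_zero (hσ : ∀ k : ℤ, σ ≠ k) :
    Complex.sin (Real.pi * σ / 2) ≠ 0 := by
  rw [Complex.sin_ne_zero_iff]
  intro k hk
  have hpi : (Real.pi : ℂ) ≠ 0 := mod_cast Real.pi_ne_zero
  refine hσ (2 * k) (mul_left_cancel₀ hpi ?_)
  push_cast
  linear_combination 2 * hk

theorem cos_half_pi_mul_ne_zero (hσ : ∀ k : ℤ, σ ≠ k) :
    Complex.cos (Real.pi * σ / 2) ≠ 0 := by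
  rw [Complex.cos_ne_zero_iff]
  intro k hk
  have hpi : (Real.pi : ℂ) ≠ 0 := mod_cast Real.pi_ne_zero
  refine hσ (2 * k + 1) (mul_left_cancel₀ hpi ?_)
  push_cast
  linear_combination 2 * hk

theorem eulerLimit_ne_zero (hσ : ∀ k : ℤ, σ ≠ k) (n : ℕ) : eulerLimit σ n ≠ 0 := by
  rw [eulerLimit]
  split_ifs
  · exact cos_half_pi_mul_ne_zero hσ
  · have := sin_half_pi_mul_ne_zero hσ
    simpa using this

end Nonvanishing

end EulerLimit

section Walks

theorem openPathWeight_eq_ite {R G : Type*} [CommSemiring R] [AddCommGroup G] [DecidableEq G]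
    (c d : G → R) (n : G) (y : List G) :
    openPathWeight c d n y = if y ≠ [] ∧ y.sum = n then
      (y.map c).prod * ∏ t ∈ Finset.Ico 1 y.length, d (n - (y.take t).sum) else 0 := by
  rcases y with _ | ⟨m, y⟩
  · simp [openPathWeight]
  · simp [openPathWeight, pathWeight_eq_ite, Finset.prod_Ico_eq_prod_range, add_comm 1,
      eq_sub_iff_add_eq', sub_sub, mul_assoc]

section Translation

variable (u : ℤˣ) (n : ℕ) (y : List ℤ)

theorem walkVertex_map (t : ℕ) : walkVertex (-(u * n)) (y.map fun k => 2 * u * k) t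
    = u * (2 * (y.take t).sum - n) := by
  rw [walkVertex, ← List.map_take, List.sum_map_mul_left, List.map_id']
  ring

theorem sq_sub_walkVertex_map_sq (t : ℕ) :
    (-(u * n) : ℤ) ^ 2 - walkVertex (-(u * n)) (y.map fun k => 2 * u * k) t ^ 2
      = vertexGap n (n - (y.take t).sum) := by
  rw [walkVertex_map, vertexGap]
  linear_combination (4 * (y.take t).sum * (n - (y.take t).sum)) * Int.units_coe_mul_self u

theorem map_mem_admissibleWalks_iff :
    (y.map fun k => 2 * (u : ℤ) * k) ∈ admissibleWalks (-(u * n)) ↔ 2 ≤ y.length ∧ y.sum = n ∧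
      ∀ t, 1 ≤ t → t < y.length → vertexGap n (n - (y.take t).sum) ≠ 0 := by
  have heven : ∀ m ∈ y.map fun k => 2 * (u : ℤ) * k, Even m := by
    simp [mul_assoc]
  have hsum : (y.map fun k => 2 * (u : ℤ) * k).sum = -2 * -(u * n) ↔ y.sum = n := by
    rw [List.sum_map_mul_left, List.map_id', neg_mul_neg, ← mul_assoc]
    exact mul_right_inj' (mul_ne_zero two_ne_zero u.ne_zero)
  have hvertex (t : ℕ) : (walkVertex (-(u * n)) (y.map fun k => 2 * (u : ℤ) * k) t ≠ -(u * n) ∧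
      walkVertex (-(u * n)) (y.map fun k => 2 * (u : ℤ) * k) t ≠ - -(u * n)) ↔
      vertexGap n (n - (y.take t).sum) ≠ 0 := by
    rw [← sq_sub_walkVertex_map_sq u, ← not_or, Ne, not_iff_not, sub_eq_zero, eq_comm (a := _ ^ 2),
      sq_eq_sq_iff_eq_or_eq_neg]
  simp only [admissibleWalks, Set.mem_ofPred_eq, List.length_map, hsum, hvertex]
  tauto

theorem openPathWeight_eq_indicator {V : ℤ → ℂ} (hV : V (2 * u * n) = 0) (z : ℂ) :
    openPathWeight (fun k => V (2 * u * k)) (vertexWeight n z) n y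
      = (admissibleWalks (-(u * n))).indicator (fun x => walkWeight V (-(u * n)) x z)
        (y.map fun k => 2 * u * k) := by
  rw [openPathWeight_eq_ite]
  by_cases hy : (y.map fun k => 2 * (u : ℤ) * k) ∈ admissibleWalks (-(u * n))
  · obtain ⟨hlen, hsum, hgap⟩ := (map_mem_admissibleWalks_iff u n y).1 hy
    have hne : y ≠ [] := List.ne_nil_of_length_pos (by lia)
    rw [if_pos ⟨hne, hsum⟩, Set.indicator_of_mem hy, walkWeight, div_eq_mul_inv,
      ← Finset.prod_inv_distrib, List.map_map, List.length_map]
    congr 1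
    refine Finset.prod_congr rfl fun t ht => ?_
    rw [Finset.mem_Ico] at ht
    rw [vertexWeight, if_neg (hgap t ht.1 ht.2), ← sq_sub_walkVertex_map_sq u]
    push_cast
    rfl
  · rw [Set.indicator_of_notMem hy]
    rw [map_mem_admissibleWalks_iff] at hy
    refine ite_eq_right_iff.2 fun ⟨hne, hsum⟩ => ?_
    rcases Nat.lt_or_ge y.length 2 with hlen | hlen
    · obtain ⟨m, rfl⟩ := List.length_eq_one_iff.1
        (le_antisymm (Nat.le_of_lt_succ hlen) (List.length_pos_iff.2 hne))
      obtain rfl : m = n := by simpa using hsum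
      simp [hV]
    · push Not at hy
      obtain ⟨t, ht1, ht2, ht⟩ := hy hlen hsum
      rw [Finset.prod_eq_zero (Finset.mem_Ico.2 ⟨ht1, ht2⟩), mul_zero]
      rw [vertexWeight, if_pos ht]

theorem hasSum_openPathWeight_iff {V : ℤ → ℂ} (hV : V (2 * u * n) = 0) (z S : ℂ) :
    HasSum (openPathWeight (fun k => V (2 * u * k)) (vertexWeight n z) n) S ↔
      HasSum (fun x : admissibleWalks (-(u * n)) => walkWeight V (-(u * n)) x z) S := by
  have hinj : Function.Injective (List.map fun k : ℤ => 2 * u * k) :=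
    List.map_injective_iff.2 (mul_right_injective₀ (mul_ne_zero two_ne_zero u.ne_zero))
  have hrange {x : List ℤ} (hx : x ∈ admissibleWalks (-(u * n))) :
      x ∈ Set.range (List.map fun k : ℤ => 2 * u * k) := by
    rw [Set.range_list_map]
    intro m hm
    obtain ⟨k, rfl⟩ := even_iff_two_dvd.1 (hx.2.1 m hm)
    exact ⟨u * k, by linear_combination 2 * k * Int.units_coe_mul_self u⟩
  refine Iff.trans ?_ (hasSum_subtype_iff_indicator
    (f := fun x => walkWeight V (-(u * n)) x z)).symm
  rw [← hinj.hasSum_iff fun x hx => Set.indicator_of_notMem (mt hrange hx) _]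
  rw [funext fun y => openPathWeight_eq_indicator u n y hV z]
  rfl

end Translation

theorem integral_exp_mul_exp (j k : ℤ) :
    ∫ x in (0 : ℝ)..Real.pi,
        Complex.exp (2 * j * Complex.I * x) * Complex.exp (-(Complex.I * (2 * k : ℤ) * x))
      = if j = k then (Real.pi : ℂ) else 0 := by
  have hexp (x : ℝ) :
      Complex.exp (2 * j * Complex.I * x) * Complex.exp (-(Complex.I * (2 * k : ℤ) * x))
        = Complex.exp (2 * (j - k : ℤ) * Complex.I * x) := by
    rw [← Complex.exp_add]
    push_cast
    ring_nf
  simp only [hexp]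
  split_ifs with hjk
  · simp [hjk]
  · have hc : 2 * ((j - k : ℤ) : ℂ) * Complex.I ≠ 0 :=
      mul_ne_zero (mul_ne_zero two_ne_zero (Int.cast_ne_zero.2 (sub_ne_zero.2 hjk)))
        Complex.I_ne_zero
    have hperiod : Complex.exp (2 * (j - k : ℤ) * Complex.I * Real.pi) = 1 :=
      Complex.exp_eq_one_iff.2 ⟨j - k, by ring⟩
    rw [integral_exp_mul_complex hc, hperiod]
    simp

theorem fourierCoeffPi_hillPotential (a b A B : ℂ) (k : ℤ) :
    fourierCoeffPi (hillPotential a b A B) (2 * k) = stepWeight b B a A k := by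
  set e : ℤ → ℝ → ℂ := fun j x =>
    Complex.exp (2 * j * Complex.I * x) * Complex.exp (-(Complex.I * (2 * k : ℤ) * x))
  have hint (c : ℂ) (j : ℤ) :
      IntervalIntegrable (fun x => c * e j x) MeasureTheory.volume 0 Real.pi :=
    Continuous.intervalIntegrable (by fun_prop) _ _
  have hexpand (x : ℝ) : hillPotential a b A B x * Complex.exp (-(Complex.I * (2 * k : ℤ) * x))
      = a * e (-1) x + b * e 1 x + A * e (-2) x + B * e 2 x := by
    simp only [hillPotential, e]
    push_cast
    ring_nf
  have hpi : (Real.pi : ℂ) ≠ 0 := mod_cast Real.pi_ne_zero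
  simp only [fourierCoeffPi, hexpand]
  rw [intervalIntegral.integral_add (((hint _ _).add (hint _ _)).add (hint _ _)) (hint _ _),
    intervalIntegral.integral_add ((hint _ _).add (hint _ _)) (hint _ _),
    intervalIntegral.integral_add (hint _ _) (hint _ _)]
  simp only [intervalIntegral.integral_const_mul, e, integral_exp_mul_exp, stepWeight,
    mul_ite, mul_zero, @eq_comm ℤ _ k]
  split_ifs <;> first | lia | (field_simp; ring)

theorem stepWeight_neg {R : Type*} [Zero R] (b B a A : R) (k : ℤ) :
    stepWeight b B a A (-k) = stepWeight a A b B k := by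
  unfold stepWeight
  split_ifs <;> first | rfl | lia

end Walks

section Asymptotics

theorem hasSum_openPathWeight_monotone {R : Type*} [Semiring R] [TopologicalSpace R]
    [IsTopologicalSemiring R] (b B : R) (d : ℤ → R) (n : ℤ) :
    HasSum (openPathWeight (stepWeight b B 0 0) d n)
      (b * monotoneSum b B d (n - 1) + B * monotoneSum b B d (n - 2)) := by
  simpa [sum_hillSteps] using hasSum_openPathWeight d
    (fun m hm => stepWeight_of_notMem b B 0 0 hm) (n := n)
    fun m _ => hasSum_monotoneSum b B d (n - m)

theorem DetourRegime.summable_and_norm_tsum_sub_le {b B a A : ℂ} {b' B' a' A' M : ℝ} {n : ℕ}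
    (h : DetourRegime b' B' a' A' M n) (hb : ‖b‖ ≤ b') (hB : ‖B‖ ≤ B') (ha : ‖a‖ ≤ a')
    (hA : ‖A‖ ≤ A') {z : ℂ} (hz : ‖z‖ ≤ 1) :
    Summable (openPathWeight (stepWeight b B a A) (vertexWeight n z) n) ∧
      ‖∑' x, openPathWeight (stepWeight b B a A) (vertexWeight n z) n x
          - (b * monotoneSum b B (fun l => (vertexGap n l : ℂ)⁻¹) (n - 1)
            + B * monotoneSum b B (fun l => (vertexGap n l : ℂ)⁻¹) (n - 2))‖
        ≤ (b' * monotoneMajorant b' B' n (n - 1) + B' * monotoneMajorant b' B' n (n - 2))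
          * ((M + 2 * (b' + B' + a' + A') * (a' + A') / b') * (Real.log n / n)) := by
  have hmajorized := MajorizedPair.openPathWeight (majorizedPair_stepWeight hb hB ha hA)
    (fun l => majorizedPair_vertexWeight n l hz) n
  have hsupersolution := h.isSupersolution.sum_openPathWeight_le
    (stepWeight_nonneg h.b_pos.le h.B_nonneg h.a_nonneg h.A_nonneg) (vertexMajorant_nonneg n)
    (fun m hm => stepWeight_of_notMem _ _ _ _ hm) n
  obtain ⟨hsummable, htsum⟩ := MajorizedPair.summable_and_tsum hmajorized
    (hasSum_openPathWeight_monotone ..) (hasSum_openPathWeight_monotone ..) hsupersolution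
  exact ⟨hsummable, htsum.norm_sub_le.trans
    (sub_le_iff_le_add'.2 (h.sum_hillSteps_le.trans_eq (mul_one_add _ _)))⟩

theorem norm_leadingFactor_I_mul_norm (β : ℂ) (n : ℕ) :
    ‖leadingFactor (Complex.I * ‖β‖) n‖ = ‖leadingFactor β n‖ := by
  simp [leadingFactor]

theorem leadingFactor_ne_zero {β : ℂ} (hβ : β ≠ 0) (n : ℕ) : leadingFactor β n ≠ 0 := by
  simp [leadingFactor, hβ, (Nat.doubleFactorial_pos _).ne']

theorem monotoneMajorant_last_le (s : ℝ) (β : ℂ) {n : ℕ} (hn : 1 ≤ n) :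
    2 * s * ‖β‖ * monotoneMajorant (2 * s * ‖β‖) (‖β‖ ^ 2) n (n - 1)
        + ‖β‖ ^ 2 * monotoneMajorant (2 * s * ‖β‖) (‖β‖ ^ 2) n (n - 2)
      ≤ ‖leadingFactor β n‖ * ‖eulerProd (Complex.I * s) n‖ := by
  set b := 2 * s * ‖β‖
  set B := ‖β‖ ^ 2
  have hb : (b : ℂ) = -2 * (Complex.I * s) * (Complex.I * ‖β‖) := by
    simp only [b, Complex.ofReal_mul, Complex.ofReal_ofNat]
    linear_combination (2 * s * ‖β‖ : ℂ) * Complex.I_mul_I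
  have hB : (B : ℂ) = -(Complex.I * ‖β‖) ^ 2 := by
    simp only [B, Complex.ofReal_pow]
    linear_combination (‖β‖ ^ 2 : ℂ) * Complex.I_mul_I
  have hmap (l : ℤ) : (monotoneMajorant b B n l : ℂ)
      = monotoneSum (b : ℂ) B (fun l => ((|(vertexGap n l : ℝ)|⁻¹ : ℝ) : ℂ)) l :=
    map_monotoneSum _ _ _ Complex.ofRealHom l
  have hd (l : ℤ) (h0 : 0 < l) (hl : l < n) :
      ((|(vertexGap n l : ℝ)|⁻¹ : ℝ) : ℂ) = (vertexGap n l : ℂ)⁻¹ := by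
    rw [abs_of_pos (Int.cast_pos.2 (vertexGap_pos h0 hl)), Complex.ofReal_inv,
      Complex.ofReal_intCast]
  refine (Real.le_norm_self _).trans_eq ?_
  rw [← Complex.norm_real, Complex.ofReal_add, Complex.ofReal_mul b, Complex.ofReal_mul B, hmap,
    hmap, hb, hB, monotoneSum_last_eq_leadingFactor _ _ hn hd, norm_mul,
    norm_leadingFactor_I_mul_norm]

theorem exists_tsum_openPathWeight_sub_le (a A σ : ℂ) {β : ℂ} (hβ : β ≠ 0) :
    ∃ C : ℝ, ∀ᶠ n : ℕ in Filter.atTop, ∀ z : ℂ, ‖z‖ ≤ 1 →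
      Summable (openPathWeight (stepWeight (-2 * σ * β) (-β ^ 2) a A) (vertexWeight n z) n) ∧
      ‖∑' x, openPathWeight (stepWeight (-2 * σ * β) (-β ^ 2) a A) (vertexWeight n z) n x
          - leadingFactor β n * eulerProd σ n‖ ≤ ‖leadingFactor β n‖ * (C * (Real.log n / n)) := by
  -- `‖σ‖ + 1` instead of `‖σ‖` makes the majorant of the step weight `-2σβ` positive.
  obtain ⟨K, hK⟩ := exists_norm_eulerProd_le (Complex.I * (‖σ‖ + 1 : ℝ))
  have hb : 0 < 2 * (‖σ‖ + 1) * ‖β‖ := by positivity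
  have hσb : ‖-2 * σ * β‖ ≤ 2 * (‖σ‖ + 1) * ‖β‖ := by
    simp only [norm_mul, norm_neg, Complex.norm_ofNat]
    gcongr
    exact le_add_of_nonneg_right zero_le_one
  obtain ⟨M, hM⟩ := exists_detourRegime hb (sq_nonneg ‖β‖) (norm_nonneg a) (norm_nonneg A)
  have hmajorant {n : ℕ} (hn : 1 ≤ n) := (monotoneMajorant_last_le (‖σ‖ + 1) β hn).trans
    (mul_le_mul_of_nonneg_left (hK n) (norm_nonneg _))
  generalize 2 * (‖σ‖ + 1) * ‖β‖ = b at *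
  refine ⟨K * (M + 2 * (b + ‖β‖ ^ 2 + ‖a‖ + ‖A‖) * (‖a‖ + ‖A‖) / b), hM.mono fun n h z hz => ?_⟩
  have hn : 1 ≤ n := by linarith [h.three_le]
  have hM_nonneg := h.M_nonneg
  obtain ⟨hsummable, hle⟩ := h.summable_and_norm_tsum_sub_le (b := -2 * σ * β) (B := -β ^ 2)
    hσb (by simp) le_rfl le_rfl hz
  rw [monotoneSum_last_eq_leadingFactor σ β hn fun l _ _ => rfl] at hle
  refine ⟨hsummable, hle.trans ?_⟩
  rw [mul_assoc K, ← mul_assoc ‖_‖ K]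
  gcongr
  exact hmajorant hn

theorem exists_tsum_openPathWeight_asymptotic (a A σ : ℂ) {β : ℂ} (hβ : β ≠ 0) :
    ∃ C : ℝ, ∀ᶠ n : ℕ in Filter.atTop, ∀ z : ℂ, ‖z‖ ≤ 1 →
      Summable (openPathWeight (stepWeight (-2 * σ * β) (-β ^ 2) a A) (vertexWeight n z) n) ∧
      ∃ ε : ℂ, ‖ε‖ ≤ C * (Real.log n / n) ∧
        ∑' x, openPathWeight (stepWeight (-2 * σ * β) (-β ^ 2) a A) (vertexWeight n z) n x
          = leadingFactor β n * (eulerLimit σ n + ε) := by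
  obtain ⟨C, hC⟩ := exists_tsum_openPathWeight_sub_le a A σ hβ
  obtain ⟨C', hC'⟩ := exists_norm_eulerProd_sub_eulerLimit_le σ
  have hC'_nonneg : 0 ≤ C' := by simpa using (norm_nonneg _).trans (hC' 1 le_rfl)
  refine ⟨C + C', ?_⟩
  filter_upwards [hC, Filter.eventually_ge_atTop 3] with n hn h3 z hz
  obtain ⟨hsummable, hle⟩ := hn z hz
  have hL := leadingFactor_ne_zero hβ n
  set S := ∑' x, openPathWeight (stepWeight (-2 * σ * β) (-β ^ 2) a A) (vertexWeight n z) n x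
  refine ⟨hsummable, S / leadingFactor β n - eulerLimit σ n, ?_, by field_simp; ring⟩
  have hsum : ‖S / leadingFactor β n - eulerProd σ n‖ ≤ C * (Real.log n / n) := by
    rwa [← mul_le_mul_iff_right₀ (norm_pos_iff.2 hL), ← norm_mul, mul_sub, mul_div_cancel₀ _ hL]
  have hprod : ‖eulerProd σ n - eulerLimit σ n‖ ≤ C' * (Real.log n / n) :=
    calc _ ≤ C' / n := hC' n (by lia)
      _ = C' * (n : ℝ)⁻¹ := div_eq_mul_inv ..
      _ ≤ C' * (Real.log n / n) := mul_le_mul_of_nonneg_left (inv_le_log_div h3) hC'_nonneg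
  calc _ ≤ _ := norm_sub_le_norm_sub_add_norm_sub ..
    _ ≤ C * (Real.log n / n) + C' * (Real.log n / n) := add_le_add hsum hprod
    _ = _ := by ring

theorem summable_walkWeight_and_tsum_eq {V : ℤ → ℂ} {b B a A : ℂ} {u : ℤˣ}
    (hV : ∀ k, V (2 * (u * k)) = stepWeight b B a A k) {n : ℕ} (hn : 3 ≤ n) {z : ℂ}
    (h : Summable (openPathWeight (stepWeight b B a A) (vertexWeight n z) n)) :
    Summable (fun x : admissibleWalks (-(u * n)) => walkWeight V (-(u * n)) x z) ∧
      ∑' x : admissibleWalks (-(u * n)), walkWeight V (-(u * n)) x z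
        = ∑' x, openPathWeight (stepWeight b B a A) (vertexWeight n z) n x := by
  have hzero : V (2 * u * n) = 0 := by
    rw [mul_assoc, hV]
    exact stepWeight_of_notMem _ _ _ _ (by
      simp only [hillSteps, Finset.mem_insert, Finset.mem_singleton]
      lia)
  have hsum := (hasSum_openPathWeight_iff u n hzero z _).1
    (by simpa only [mul_assoc, hV] using h.hasSum)
  exact ⟨hsum.summable, hsum.tsum_eq⟩

theorem exists_walkSumPlus_asymptotic (a A σ : ℂ) {β : ℂ} (hβ : β ≠ 0) :
    ∃ C : ℝ, ∀ᶠ n : ℕ in Filter.atTop, ∀ z : ℂ, ‖z‖ ≤ 1 →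
      Summable (fun x : admissibleWalks (-(n : ℤ)) =>
        walkWeight (fourierCoeffPi (hillPotential a (-2 * σ * β) A (-β ^ 2))) (-(n : ℤ)) x z) ∧
      ∃ ε : ℂ, ‖ε‖ ≤ C * (Real.log n / n) ∧
        walkSumPlus (hillPotential a (-2 * σ * β) A (-β ^ 2)) n z
          = leadingFactor β n * (eulerLimit σ n + ε) := by
  obtain ⟨C, hC⟩ := exists_tsum_openPathWeight_asymptotic a A σ hβ
  refine ⟨C, ?_⟩
  filter_upwards [hC, Filter.eventually_ge_atTop 3] with n hn h3 z hz
  obtain ⟨hsummable, ε, hε, htsum⟩ := hn z hz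
  obtain ⟨hsummable', htsum'⟩ := summable_walkWeight_and_tsum_eq (u := 1)
    (V := fourierCoeffPi _)
    (fun k => by rw [Units.val_one, one_mul, fourierCoeffPi_hillPotential]) h3 hsummable
  rw [Units.val_one, one_mul] at hsummable' htsum'
  exact ⟨hsummable', ε, hε, htsum'.trans htsum⟩

theorem exists_walkSumMinus_asymptotic (b B τ : ℂ) {α : ℂ} (hα : α ≠ 0) :
    ∃ C : ℝ, ∀ᶠ n : ℕ in Filter.atTop, ∀ z : ℂ, ‖z‖ ≤ 1 →
      Summable (fun x : admissibleWalks (n : ℤ) =>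
        walkWeight (fourierCoeffPi (hillPotential (-2 * τ * α) b (-α ^ 2) B)) (n : ℤ) x z) ∧
      ∃ ε : ℂ, ‖ε‖ ≤ C * (Real.log n / n) ∧
        walkSumMinus (hillPotential (-2 * τ * α) b (-α ^ 2) B) n z
          = leadingFactor α n * (eulerLimit τ n + ε) := by
  obtain ⟨C, hC⟩ := exists_tsum_openPathWeight_asymptotic b B τ hα
  refine ⟨C, ?_⟩
  filter_upwards [hC, Filter.eventually_ge_atTop 3] with n hn h3 z hz
  obtain ⟨hsummable, ε, hε, htsum⟩ := hn z hz
  obtain ⟨hsummable', htsum'⟩ := summable_walkWeight_and_tsum_eq (u := -1)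
    (V := fourierCoeffPi _) (fun k => by
      rw [Units.val_neg, Units.val_one, neg_one_mul, fourierCoeffPi_hillPotential, stepWeight_neg])
    h3 hsummable
  rw [Units.val_neg, Units.val_one, neg_one_mul, neg_neg] at hsummable' htsum'
  exact ⟨hsummable', ε, hε, htsum'.trans htsum⟩

theorem exists_relative_asymptotic {σ : ℂ} (hσ : ∀ k : ℤ, σ ≠ k) :
    ∃ R₀ : ℝ, ∀ R ≥ R₀, ∀ (β S : ℂ) (n : ℕ) (K : ℝ),
      (∃ ε : ℂ, ‖ε‖ ≤ K ∧ S = leadingFactor β n * (eulerLimit σ n + ε)) →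
      (Even n → ∃ ε : ℂ, ‖ε‖ ≤ R * K ∧
        S = 4 * (Complex.I * β / 2) ^ n / (Nat.doubleFactorial (n - 2) : ℂ) ^ 2
          * Complex.cos (Real.pi * σ / 2) * (1 + ε)) ∧
      (Odd n → ∃ ε : ℂ, ‖ε‖ ≤ R * K ∧
        S = 4 * Complex.I * (Complex.I * β / 2) ^ n / (Nat.doubleFactorial (n - 2) : ℂ) ^ 2
          * (2 / Real.pi) * Complex.sin (Real.pi * σ / 2) * (1 + ε)) := by
  refine ⟨max ‖(eulerLimit σ 0)⁻¹‖ ‖(eulerLimit σ 1)⁻¹‖, fun R hR β S n K => ?_⟩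
  rintro ⟨ε, hε, rfl⟩
  have hinv : ‖(eulerLimit σ n)⁻¹‖ ≤ R := by
    refine le_trans ?_ hR
    rcases Nat.even_or_odd n with hn | hn
    · simp [eulerLimit, hn]
    · simp [eulerLimit, Nat.not_even_iff_odd.2 hn]
  have hbound : ‖(eulerLimit σ n)⁻¹ * ε‖ ≤ R * K := norm_mul_le_of_le hinv hε
  have hrel : eulerLimit σ n + ε = eulerLimit σ n * (1 + (eulerLimit σ n)⁻¹ * ε) := by
    rw [mul_add, mul_one, mul_inv_cancel_left₀ (eulerLimit_ne_zero hσ n)]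
  rw [hrel]
  refine ⟨fun hn => ⟨_, hbound, ?_⟩, fun hn => ⟨_, hbound, ?_⟩⟩
  · rw [leadingFactor, ← mul_assoc, eulerLimit, if_pos hn]
  · rw [leadingFactor, ← mul_assoc, eulerLimit, if_neg (Nat.not_even_iff_odd.2 hn)]
    ring

end Asymptotics

theorem mainTheorem5_general (a b A B α β τ σ : ℂ) (hA : A ≠ 0) (hB : B ≠ 0)
    (hAα : A = -α ^ 2) (haτ : a = -2 * τ * α) (hBβ : B = -β ^ 2) (hbσ : b = -2 * σ * β) :
    ∃ (C : ℝ) (N : ℕ), ∀ n : ℕ, N ≤ n → ∀ z : ℂ, ‖z‖ ≤ 1 →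
      Summable (fun x : admissibleWalks (-(n : ℤ)) =>
        walkWeight (fourierCoeffPi (hillPotential a b A B)) (-(n : ℤ)) x z) ∧
      Summable (fun x : admissibleWalks (n : ℤ) =>
        walkWeight (fourierCoeffPi (hillPotential a b A B)) (n : ℤ) x z) ∧
      (∃ ε : ℂ, ‖ε‖ ≤ C * (Real.log n / n) ∧
        walkSumPlus (hillPotential a b A B) n z = leadingFactor β n * (eulerLimit σ n + ε)) ∧
      ∃ ε : ℂ, ‖ε‖ ≤ C * (Real.log n / n) ∧
        walkSumMinus (hillPotential a b A B) n z = leadingFactor α n * (eulerLimit τ n + ε) := by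
  subst hAα haτ hBβ hbσ
  have hα : α ≠ 0 := by simpa using hA
  have hβ : β ≠ 0 := by simpa using hB
  obtain ⟨Cp, hCp⟩ := exists_walkSumPlus_asymptotic (-2 * τ * α) (-α ^ 2) σ hβ
  obtain ⟨Cm, hCm⟩ := exists_walkSumMinus_asymptotic (-2 * σ * β) (-β ^ 2) τ hα
  obtain ⟨N, hN⟩ := Filter.eventually_atTop.1 (hCp.and hCm)
  refine ⟨max Cp Cm, N, fun n hn z hz => ?_⟩
  obtain ⟨hsp, εp, hεp, hplus⟩ := (hN n hn).1 z hz
  obtain ⟨hsm, εm, hεm, hminus⟩ := (hN n hn).2 z hz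
  refine ⟨hsp, hsm, ⟨εp, hεp.trans ?_, hplus⟩, ⟨εm, hεm.trans ?_, hminus⟩⟩
  · gcongr
    exact le_max_left ..
  · gcongr
    exact le_max_right ..

theorem mainTheorem5 (a b A B α β τ σ : ℂ)
    (ha : a ≠ 0) (hb : b ≠ 0) (hA : A ≠ 0) (hB : B ≠ 0)
    (hAα : A = -α ^ 2) (haτ : a = -2 * τ * α) (hBβ : B = -β ^ 2) (hbσ : b = -2 * σ * β)
    (hτ : ∀ k : ℤ, τ ≠ (k : ℂ)) (hσ : ∀ k : ℤ, σ ≠ (k : ℂ)) :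
    ∃ (C : ℝ) (N : ℕ), ∀ n : ℕ, N ≤ n → ∀ z : ℂ, ‖z‖ ≤ 1 →
      -- the series that define `B⁺(n, z)` and `B⁻(n, z)` converge (absolutely)
      Summable (fun x : admissibleWalks (-(n : ℤ)) =>
        walkWeight (fourierCoeffPi (hillPotential a b A B)) (-(n : ℤ)) x z) ∧
      Summable (fun x : admissibleWalks (n : ℤ) =>
        walkWeight (fourierCoeffPi (hillPotential a b A B)) (n : ℤ) x z) ∧
      (Even n →
        (∃ ε : ℂ, ‖ε‖ ≤ C * (Real.log n / n) ∧
          walkSumPlus (hillPotential a b A B) n z =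
            4 * (Complex.I * β / 2) ^ n / (Nat.doubleFactorial (n - 2) : ℂ) ^ 2
              * Complex.cos (Real.pi * σ / 2) * (1 + ε)) ∧
        (∃ ε : ℂ, ‖ε‖ ≤ C * (Real.log n / n) ∧
          walkSumMinus (hillPotential a b A B) n z =
            4 * (Complex.I * α / 2) ^ n / (Nat.doubleFactorial (n - 2) : ℂ) ^ 2
              * Complex.cos (Real.pi * τ / 2) * (1 + ε))) ∧
      (Odd n →
        (∃ ε : ℂ, ‖ε‖ ≤ C * (Real.log n / n) ∧
          walkSumPlus (hillPotential a b A B) n z =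
            4 * Complex.I * (Complex.I * β / 2) ^ n / (Nat.doubleFactorial (n - 2) : ℂ) ^ 2
              * (2 / Real.pi) * Complex.sin (Real.pi * σ / 2) * (1 + ε)) ∧
        (∃ ε : ℂ, ‖ε‖ ≤ C * (Real.log n / n) ∧
          walkSumMinus (hillPotential a b A B) n z =
            4 * Complex.I * (Complex.I * α / 2) ^ n / (Nat.doubleFactorial (n - 2) : ℂ) ^ 2
              * (2 / Real.pi) * Complex.sin (Real.pi * τ / 2) * (1 + ε))) := by
  obtain ⟨C, N, hCN⟩ := mainTheorem5_general a b A B α β τ σ hA hB hAα haτ hBβ hbσ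
  obtain ⟨Rσ, hRσ⟩ := exists_relative_asymptotic hσ
  obtain ⟨Rτ, hRτ⟩ := exists_relative_asymptotic hτ
  refine ⟨max Rσ Rτ * C, N, fun n hn z hz => ?_⟩
  obtain ⟨hsummable_plus, hsummable_minus, hplus, hminus⟩ := hCN n hn z hz
  rw [mul_assoc]
  have hplus' := hRσ _ (le_max_left Rσ Rτ) _ _ _ _ hplus
  have hminus' := hRτ _ (le_max_right Rσ Rτ) _ _ _ _ hminus
  exact ⟨hsummable_plus, hsummable_minus, fun hn => ⟨hplus'.1 hn, hminus'.1 hn⟩,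
    fun hn => ⟨hplus'.2 hn, hminus'.2 hn⟩⟩
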